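/- Let $\mathbb{M}_m$ be the space of $m\times m$ complex matrices. A norm $\|\cdot\|$ on $\mathbb{M}_m$ is unitarily invariant if $\|UXV\|=\|X\|$ for all $X\in\mathbb{M}_m$ and all unitary $U,V\in\mathbb{M}_m$, and it is strictly increasing if, for all positive semidefinite $A,B\in\mathbb{M}_m$, the relations $A\le B$ (i.e. $B-A$ is positive semidefinite) and $\|A\|=\|B\|$ imply $A=B$. (1) Let $\|\cdot\|$ be a strictly increasing unitarily invariant norm on $\mathbb{M}_m$, let $A,B\in\mathbb{M}_m$ be positive semidefinite, and let $0<p<q$. Then $$\bigl\|(A^{p/2}B^pA^{p/2})^{1/p}\bigr\|\le\bigl\|(A^{q/2}B^qA^{q/2})^{1/q}\bigr\|,$$ and equality holds if and only if $AB=BA$. In particular, if equality holds for some $0<p<q$, then $AB=BA$; equivalently, if $p\mapsto\|(A^{p/2}B^pA^{p/2})^{1/p}\|$ is not strictly increasing on $(0,\infty)$, then $AB=BA$. (2) For Hermitian $H_1,H_2\in\mathbb{M}_m$, the equality $\mathrm{Tr}\,e^{H_1+H_2}=\mathrm{Tr}\,e^{H_1}e^{H_2}$ in the Golden--Thompson inequality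 holds if and only if $H_1H_2=H_2H_1$. -/

import Mathlib

open scoped MatrixOrder ComplexOrder

/-- A norm on the complex vector space of `m × m` complex matrices that satisfies
`‖U X V‖ = ‖X‖` for all unitary `U`, `V`. -/
structure IsUnitarilyInvariantNorm {m : ℕ} (N : Seminorm ℂ (Matrix (Fin m) (Fin m) ℂ)) :
    Prop where
  definite : ∀ X : Matrix (Fin m) (Fin m) ℂ, N X = 0 → X = 0
  unitary_invariant : ∀ U ∈ Matrix.unitaryGroup (Fin m) ℂ, ∀ V ∈ Matrix.unitaryGroup (Fin m) ℂ,
    ∀ X : Matrix (Fin m) (Fin m) ℂ, N (U * X * V) = N X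

/-- `N` is strictly increasing: for positive semidefinite `A ≤ B` (Loewner order),
`N A = N B` forces `A = B`. -/
def IsStrictlyIncreasingNorm {m : ℕ} (N : Seminorm ℂ (Matrix (Fin m) (Fin m) ℂ)) : Prop :=
  ∀ A B : Matrix (Fin m) (Fin m) ℂ, A.PosSemidef → B.PosSemidef → A ≤ B → N A = N B → A = B

/-- `(A ^ (p/2) * B ^ p * A ^ (p/2)) ^ (1/p)`, the powers being real powers of positive
semidefinite matrices in the sense of the functional calculus. -/
noncomputable def arakiMean {m : ℕ} (A B : Matrix (Fin m) (Fin m) ℂ) (p : ℝ) :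
    Matrix (Fin m) (Fin m) ℂ :=
  (A ^ (p / 2) * B ^ p * A ^ (p / 2)) ^ (1 / p)

/-! Let P_k(p) be the product of the k largest eigenvalues of `arakiCore A B p`. Everything rests on
its log-convexity in p, proved at midpoints by Cauchy–Binet and Cauchy–Schwarz
(`prod_eigSeq_arakiCore_midpoint`). Since P_k(0) = 1, convexity gives P_k(p) ≤ P_k(q)^(p/q): the
spectrum of the mean at p is weakly log-majorized by that at q. A unitarily invariant norm of a
positive matrix is attained by pairing its eigenvalues with nonnegative decreasing weights, and such
pairings respect weak log-majorization (`sum_mul_le_sum_mul_of_prod_le`); the norm inequality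
follows.

If the norms agree, strictness makes the weights positive wherever the smaller spectrum is, so the
spectra coincide and P_k(p) = P_k(q)^(p/q) for all k. Equality at one interior point of a log-convex
function forces P_k(q) = P_k(q/2)^2, and summing eigenvalues turns this into Tr E²D² = Tr (ED)² with
E = A^(q/2), D = B^(q/2). The commutator of E and D then has zero Hilbert–Schmidt norm. Conversely,
if AB = BA, the mean equals AB for every p.

For Golden–Thompson, the trace of the mean of e^H and e^K is monotone in p, tends to Tr e^(H+K)
along p = 1/n, and equals Tr e^H e^K at p = 1. Equality makes the traces at 1/2 and 1 agree, and the
same commutator argument applies. -/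

open Finset in
/-- Abel summation: a nonnegative antitone weight preserves nonnegativity of partial sums. -/
theorem sum_mul_nonneg_of_antitone {n : ℕ} {d l : ℕ → ℝ} (hd : Antitone d) (hd0 : ∀ i, 0 ≤ d i)
    (h : ∀ k ≤ n, 0 ≤ ∑ i ∈ range k, l i) : 0 ≤ ∑ i ∈ range n, d i * l i := by
  have key : ∀ k ≤ n, d k * ∑ i ∈ range k, l i ≤ ∑ i ∈ range k, d i * l i := by
    intro k
    induction k with
    | zero => simp
    | succ k ih =>
      intro hk
      have h1 := ih (by omega)
      have h2 := mul_le_mul_of_nonneg_right (hd (Nat.le_succ k)) (h (k + 1) hk)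
      rw [sum_range_succ, sum_range_succ] at *
      simp only [Nat.succ_eq_add_one] at *
      nlinarith
  exact (mul_nonneg (hd0 n) (h n le_rfl)).trans (key n le_rfl)

/-! ### Weak log-majorization and weighted sums. -/

section WeakLogMajorization

open Finset

variable {n : ℕ} {a b : ℕ → ℝ}

theorem pos_of_prod_range_le (ha : Antitone a) (hb0 : ∀ i, 0 ≤ b i)
    (h : ∀ k ≤ n, ∏ i ∈ range k, a i ≤ ∏ i ∈ range k, b i) {i : ℕ} (hi : i < n)
    (hai : 0 < a i) : 0 < b i := by
  refine lt_of_le_of_ne (hb0 i) fun hbi => ?_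
  have h1 := h (i + 1) hi
  rw [prod_range_succ b, ← hbi, mul_zero] at h1
  exact absurd h1 (not_le.2 (prod_pos fun j hj =>
    hai.trans_le (ha (by simpa [Nat.lt_succ_iff] using hj))))

theorem sum_range_log_div_nonneg (ha : Antitone a) (ha0 : ∀ i, 0 ≤ a i) (hb0 : ∀ i, 0 ≤ b i)
    (h : ∀ k ≤ n, ∏ i ∈ range k, a i ≤ ∏ i ∈ range k, b i) :
    ∀ k ≤ n, 0 ≤ ∑ i ∈ range k, Real.log (b i / a i) := by
  intro k
  induction k with
  | zero => simp
  | succ k ih =>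
    intro hk
    rcases (ha0 k).eq_or_lt with h0 | h0
    · rw [sum_range_succ, ← h0]
      simpa using ih (by omega)
    · have hpa : ∀ i ∈ range (k + 1), 0 < a i := fun i hi =>
        h0.trans_le (ha (by simpa [Nat.lt_succ_iff] using hi))
      have hpb : ∀ i ∈ range (k + 1), 0 < b i := fun i hi =>
        pos_of_prod_range_le ha hb0 h ((mem_range.1 hi).trans_le hk) (hpa i hi)
      rw [← Real.log_prod (fun i hi => (div_pos (hpb i hi) (hpa i hi)).ne'), prod_div_distrib]
      exact Real.log_nonneg ((one_le_div (prod_pos hpa)).2 (h _ hk))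

/-- This is log u ≤ u - 1 at u = y / x. The case y = 0 < x must be excluded because `Real.log 0 =
0`. -/
theorem mul_log_div_le_sub {x y : ℝ} (hx : 0 ≤ x) (hy : 0 ≤ y) (hxy : 0 < x → 0 < y) :
    x * Real.log (y / x) ≤ y - x := by
  rcases hx.eq_or_lt with rfl | hx
  · simpa using hy
  · have := mul_le_mul_of_nonneg_left (Real.log_le_sub_one_of_pos (div_pos (hxy hx) hx)) hx.le
    rwa [mul_sub, mul_div_cancel₀ _ hx.ne', mul_one] at this

/-- Weak log-majorization implies domination of all sums with nonnegative antitone weights. -/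
theorem sum_mul_le_sum_mul_of_prod_le {c : ℕ → ℝ} (ha : Antitone a) (ha0 : ∀ i, 0 ≤ a i)
    (hb0 : ∀ i, 0 ≤ b i) (hc : Antitone c) (hc0 : ∀ i, 0 ≤ c i)
    (h : ∀ k ≤ n, ∏ i ∈ range k, a i ≤ ∏ i ∈ range k, b i) :
    ∑ i ∈ range n, c i * a i ≤ ∑ i ∈ range n, c i * b i ∧
    (∑ i ∈ range n, c i * a i = ∑ i ∈ range n, c i * b i →
      ∀ i < n, 0 < c i → 0 < a i → a i = b i) := by
  -- The weights c_i a_i are again nonnegative and antitone, so Abel summation applies to the log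
  -- ratios.
  have h1 : 0 ≤ ∑ i ∈ range n, (c i * a i) * Real.log (b i / a i) :=
    sum_mul_nonneg_of_antitone
      (fun i j hij => mul_le_mul (hc hij) (ha hij) (ha0 _) (hc0 _))
      (fun i => mul_nonneg (hc0 i) (ha0 i)) (sum_range_log_div_nonneg ha ha0 hb0 h)
  have h2 : ∀ i ∈ range n, (c i * a i) * Real.log (b i / a i) ≤ c i * (b i - a i) := fun i hi => by
    rw [mul_assoc]
    exact mul_le_mul_of_nonneg_left (mul_log_div_le_sub (ha0 i) (hb0 i)
      (pos_of_prod_range_le ha hb0 h (mem_range.1 hi))) (hc0 i)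
  have h3 : ∑ i ∈ range n, c i * (b i - a i)
      = ∑ i ∈ range n, c i * b i - ∑ i ∈ range n, c i * a i := by
    rw [← sum_sub_distrib]
    exact sum_congr rfl fun i _ => by ring
  refine ⟨by linarith [sum_le_sum h2], fun heq i hi hci hai => ?_⟩
  have h4 : ∑ i ∈ range n, (c i * a i) * Real.log (b i / a i) = ∑ i ∈ range n, c i * (b i - a i) :=
    le_antisymm (sum_le_sum h2) (by linarith)
  -- Equality of the sums is equality term by term, and log u < u - 1 unless u = 1.
  have h5 := (sum_eq_sum_iff_of_le h2).1 h4 i (mem_range.2 hi)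
  by_contra hne
  have hbi := pos_of_prod_range_le ha hb0 h hi hai
  have h6 := Real.log_lt_sub_one_of_pos (div_pos hbi hai) (fun h => hne ((div_eq_one_iff_eq hai.ne').1 h).symm)
  have h7 := mul_lt_mul_of_pos_left h6 (mul_pos hci hai)
  rw [h5] at h7
  have : c i * a i * (b i / a i - 1) = c i * (b i - a i) := by field_simp
  linarith

end WeakLogMajorization

/-! ### Midpoint log-convexity without continuity. -/

section MidpointConvexity

open Set

/-- An upper bound replaces continuity: every x is the midpoint of an endpoint and another point of
the interval, so each iteration halves the bound C. -/
theorem nonpos_of_midpoint_convex {φ : ℝ → ℝ} {C : ℝ} (h0 : φ 0 ≤ 0) (h1 : φ 1 ≤ 0)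
    (hC : ∀ x ∈ Icc (0 : ℝ) 1, φ x ≤ C)
    (hmid : ∀ x ∈ Icc (0 : ℝ) 1, ∀ y ∈ Icc (0 : ℝ) 1, φ ((x + y) / 2) ≤ (φ x + φ y) / 2)
    {x : ℝ} (hx : x ∈ Icc (0 : ℝ) 1) : φ x ≤ 0 := by
  have key : ∀ n : ℕ, ∀ x ∈ Icc (0 : ℝ) 1, φ x ≤ C * (1 / 2) ^ n := by
    intro n
    induction n with
    | zero => simpa using hC
    | succ n ih =>
      intro x hx
      rw [pow_succ]
      rcases le_total x (1 / 2) with h | h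
      · have hm : 2 * x ∈ Icc (0 : ℝ) 1 := ⟨by linarith [hx.1], by linarith⟩
        have := hmid 0 (by simp) (2 * x) hm
        rw [show (0 + 2 * x) / 2 = x by ring] at this
        linarith [ih _ hm]
      · have hm : 2 * x - 1 ∈ Icc (0 : ℝ) 1 := ⟨by linarith [hx.1], by linarith [hx.2]⟩
        have := hmid 1 (by simp) (2 * x - 1) hm
        rw [show (1 + (2 * x - 1)) / 2 = x by ring] at this
        linarith [ih _ hm]
  have hlim : Filter.Tendsto (fun n : ℕ => C * (1 / 2 : ℝ) ^ n) Filter.atTop (nhds (C * 0)) :=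
    (tendsto_pow_atTop_nhds_zero_of_lt_one (by norm_num) (by norm_num)).const_mul C
  rw [mul_zero] at hlim
  exact ge_of_tendsto' hlim fun n => key n x hx

variable {g : ℝ → ℝ} {q M : ℝ}

theorem le_rpow_mul_rpow_of_midpoint_of_pos (h0 : ∀ x ∈ Icc 0 q, 0 < g x)
    (hM : ∀ x ∈ Icc 0 q, g x ≤ M)
    (hmid : ∀ x ∈ Icc 0 q, ∀ y ∈ Icc 0 q, g ((x + y) / 2) ^ 2 ≤ g x * g y)
    {x y : ℝ} (hx : x ∈ Icc 0 q) (hy : y ∈ Icc 0 q) {θ : ℝ} (hθ : θ ∈ Icc (0 : ℝ) 1) :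
    g (θ * x + (1 - θ) * y) ≤ g x ^ θ * g y ^ (1 - θ) := by
  have hmem : ∀ t ∈ Icc (0 : ℝ) 1, t * x + (1 - t) * y ∈ Icc 0 q := fun t ht =>
    (convex_Icc 0 q) hx hy ht.1 (by linarith [ht.2]) (by ring)
  set φ : ℝ → ℝ := fun t => Real.log (g (t * x + (1 - t) * y)) -
    (t * Real.log (g x) + (1 - t) * Real.log (g y)) with hφ
  have hφ0 : φ θ ≤ 0 := by
    refine nonpos_of_midpoint_convex (C := Real.log M + (|Real.log (g x)| + |Real.log (g y)|))
      (by simp [hφ]) (by simp [hφ]) (fun t ht => ?_) (fun s hs t ht => ?_) hθ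
    · have h1 := Real.log_le_log (h0 _ (hmem t ht)) (hM _ (hmem t ht))
      have h2 : -|Real.log (g x)| ≤ t * Real.log (g x) := by
        have := neg_abs_le (Real.log (g x))
        nlinarith [ht.1, ht.2, abs_nonneg (Real.log (g x))]
      have h3 : -|Real.log (g y)| ≤ (1 - t) * Real.log (g y) := by
        have := neg_abs_le (Real.log (g y))
        nlinarith [ht.1, ht.2, abs_nonneg (Real.log (g y))]
      simp only [hφ]
      linarith
    · have hs' := hmem s hs
      have ht' := hmem t ht
      have hst : (s + t) / 2 * x + (1 - (s + t) / 2) * y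
          = ((s * x + (1 - s) * y) + (t * x + (1 - t) * y)) / 2 := by ring
      have hpos : 0 < g (((s * x + (1 - s) * y) + (t * x + (1 - t) * y)) / 2) := by
        rw [← hst]
        exact h0 _ (hmem _ ⟨by linarith [hs.1, ht.1], by linarith [hs.2, ht.2]⟩)
      have h1 := Real.log_le_log (pow_pos hpos 2) (hmid _ hs' _ ht')
      rw [Real.log_pow, Real.log_mul (h0 _ hs').ne' (h0 _ ht').ne'] at h1
      simp only [hφ, hst]
      push_cast at h1
      linarith
  rw [Real.rpow_def_of_pos (h0 _ hx), Real.rpow_def_of_pos (h0 _ hy), ← Real.exp_add,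
    ← Real.log_le_iff_le_exp (h0 _ (hmem θ hθ))]
  simp only [hφ] at hφ0
  linarith

/-- Zeros of g are avoided by passing to g + ε, which inherits the midpoint inequality by AM–GM;
then ε → 0. -/
theorem le_rpow_mul_rpow_of_midpoint (h0 : ∀ x ∈ Icc 0 q, 0 ≤ g x)
    (hM : ∀ x ∈ Icc 0 q, g x ≤ M)
    (hmid : ∀ x ∈ Icc 0 q, ∀ y ∈ Icc 0 q, g ((x + y) / 2) ^ 2 ≤ g x * g y)
    {x y : ℝ} (hx : x ∈ Icc 0 q) (hy : y ∈ Icc 0 q) {θ : ℝ} (hθ : θ ∈ Ioo (0 : ℝ) 1) :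
    g (θ * x + (1 - θ) * y) ≤ g x ^ θ * g y ^ (1 - θ) := by
  have key : ∀ ε ∈ Ioi (0 : ℝ),
      g (θ * x + (1 - θ) * y) ≤ (g x + ε) ^ θ * (g y + ε) ^ (1 - θ) := fun ε hε => by
    have hε' : 0 < ε := hε
    refine le_trans (by linarith) (le_rpow_mul_rpow_of_midpoint_of_pos (g := fun x => g x + ε)
      (M := M + ε) (fun x hx => by linarith [h0 x hx]) (fun x hx => by linarith [hM x hx])
      (fun u hu v hv => ?_) hx hy (Ioo_subset_Icc_self hθ))
    have hu0 := h0 u hu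
    have hv0 := h0 v hv
    have huv := hmid u hu v hv
    have hle : 2 * g ((u + v) / 2) ≤ g u + g v := by
      refine (pow_le_pow_iff_left₀ (mul_nonneg zero_le_two (h0 _ ?_)) (by linarith) two_ne_zero).1 ?_
      · exact ⟨by linarith [hu.1, hv.1], by linarith [hu.2, hv.2]⟩
      nlinarith [sq_nonneg (g u - g v)]
    nlinarith
  have hlim : Filter.Tendsto (fun ε : ℝ => (g x + ε) ^ θ * (g y + ε) ^ (1 - θ))
      (nhdsWithin 0 (Ioi 0)) (nhds ((g x + 0) ^ θ * (g y + 0) ^ (1 - θ))) := by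
    have hc : Continuous fun ε : ℝ => (g x + ε) ^ θ * (g y + ε) ^ (1 - θ) :=
      ((continuous_const.add continuous_id).rpow_const fun _ => Or.inr hθ.1.le).mul
        ((continuous_const.add continuous_id).rpow_const fun _ => Or.inr (by linarith [hθ.2]))
    exact (hc.tendsto 0).mono_left nhdsWithin_le_nhds
  rw [add_zero, add_zero] at hlim
  exact ge_of_tendsto hlim (Filter.eventually_of_mem self_mem_nhdsWithin key)

theorem le_rpow_div_of_midpoint (h0 : ∀ x ∈ Icc 0 q, 0 ≤ g x)
    (hM : ∀ x ∈ Icc 0 q, g x ≤ M)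
    (hmid : ∀ x ∈ Icc 0 q, ∀ y ∈ Icc 0 q, g ((x + y) / 2) ^ 2 ≤ g x * g y)
    (hg : g 0 = 1) {p r : ℝ} (hp : 0 < p) (hpr : p < r) (hrq : r ≤ q) : g p ≤ g r ^ (p / r) := by
  have hr : 0 < r := hp.trans hpr
  have := le_rpow_mul_rpow_of_midpoint h0 hM hmid (x := r) (y := 0) ⟨hr.le, hrq⟩
    ⟨le_rfl, hr.le.trans hrq⟩ (θ := p / r) ⟨by positivity, (div_lt_one hr).2 hpr⟩
  rwa [hg, Real.one_rpow, mul_one, mul_zero, add_zero, div_mul_cancel₀ _ hr.ne'] at this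

/-- Log-convexity is tight at p on [0, q], hence tight at q / 2 too. If p < q / 2, interpolate p
between 0 and q / 2; if p > q / 2, between q / 2 and q. -/
theorem le_sq_half_of_midpoint (h0 : ∀ x ∈ Icc 0 q, 0 ≤ g x)
    (hM : ∀ x ∈ Icc 0 q, g x ≤ M)
    (hmid : ∀ x ∈ Icc 0 q, ∀ y ∈ Icc 0 q, g ((x + y) / 2) ^ 2 ≤ g x * g y)
    (hg : g 0 = 1) {p : ℝ} (hp : 0 < p) (hpq : p < q) (heq : g p = g q ^ (p / q)) :
    g q ≤ g (q / 2) ^ 2 := by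
  have hq : 0 < q := hp.trans hpq
  have hq0 := h0 q ⟨hq.le, le_rfl⟩
  have hh0 := h0 (q / 2) ⟨by linarith, by linarith⟩
  rcases hq0.eq_or_lt with hz | hpos
  · rw [← hz]
    positivity
  suffices ∃ e : ℝ, 0 < e ∧ (g q) ^ e ≤ (g (q / 2) ^ 2) ^ e by
    obtain ⟨e, he, hle⟩ := this
    exact (Real.rpow_le_rpow_iff hq0 (by positivity) he).1 hle
  have hsq : ∀ e : ℝ, (g (q / 2) ^ 2) ^ e = g (q / 2) ^ (2 * e) := fun e => by
    rw [← Real.rpow_natCast, ← Real.rpow_mul hh0]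
    norm_num
  rcases lt_trichotomy p (q / 2) with h | h | h
  · refine ⟨p / q, by positivity, ?_⟩
    have := le_rpow_div_of_midpoint h0 hM hmid hg hp h (by linarith)
    rw [hsq, ← heq]
    convert this using 2
    field_simp
  · refine ⟨1 / 2, by norm_num, ?_⟩
    rw [show p / q = 1 / 2 by rw [h]; field_simp] at heq
    rw [hsq, ← heq, h]
    norm_num
  · have hθ : 2 * (q - p) / q ∈ Ioo (0 : ℝ) 1 :=
      ⟨div_pos (by linarith) hq, (div_lt_one hq).2 (by linarith)⟩
    have := le_rpow_mul_rpow_of_midpoint h0 hM hmid (x := q / 2) (y := q)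
      ⟨by linarith, by linarith⟩ ⟨hq.le, le_rfl⟩ hθ
    rw [show 2 * (q - p) / q * (q / 2) + (1 - 2 * (q - p) / q) * q = p by field_simp; ring, heq,
      ← div_le_iff₀ (Real.rpow_pos_of_pos hpos _), ← Real.rpow_sub hpos] at this
    refine ⟨(q - p) / q, div_pos (by linarith) hq, ?_⟩
    rw [hsq, ← mul_div_assoc]
    rwa [show p / q - (1 - 2 * (q - p) / q) = (q - p) / q by field_simp; ring] at this

end MidpointConvexity

/-! ### Cauchy–Binet formula. -/

section CauchyBinet

open Finset Matrix

variable {ι R : Type*} [Fintype ι] [CommRing R] {k : ℕ}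

theorem Matrix.det_mul_eq_sum_prod_mul_det (M : Matrix (Fin k) ι R) (N : Matrix ι (Fin k) R) :
    (M * N).det = ∑ f : Fin k → ι, (∏ i, M i (f i)) * (N.submatrix f id).det := by
  classical
  have h : M * N = Matrix.of fun i => ∑ j, M i j • N j := by
    ext i j
    simp [Matrix.mul_apply, Finset.sum_apply]
  rw [h]
  change Matrix.detRowAlternating (fun i => ∑ j, M i j • N j) = _
  rw [← AlternatingMap.coe_multilinearMap, MultilinearMap.map_sum]
  refine sum_congr rfl fun f _ => ?_
  rw [MultilinearMap.map_smul_univ, smul_eq_mul]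
  rfl

/-- The Cauchy–Binet formula, summed over all index functions. -/
theorem Matrix.factorial_mul_det_mul (M : Matrix (Fin k) ι R) (N : Matrix ι (Fin k) R) :
    (k.factorial : R) * (M * N).det =
      ∑ f : Fin k → ι, (M.submatrix id f).det * (N.submatrix f id).det := by
  classical
  -- Reindexing f as f ∘ σ costs the sign of σ; summing over all σ assembles the minor of M and
  -- produces the factor k!.
  have h : ∀ σ : Equiv.Perm (Fin k), (M * N).det = ∑ f : Fin k → ι,
      ((Equiv.Perm.sign σ : ℤ) : R) * (∏ i, M i (f (σ i))) * (N.submatrix f id).det := fun σ => by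
    rw [Matrix.det_mul_eq_sum_prod_mul_det,
      ← Equiv.sum_comp (σ.symm.arrowCongr (Equiv.refl ι))]
    refine sum_congr rfl fun f _ => ?_
    have : N.submatrix ((σ.symm.arrowCongr (Equiv.refl ι)) f) id
        = (N.submatrix f id).submatrix σ id := by
      ext i j; rfl
    rw [this, Matrix.det_permute]
    simp only [Equiv.arrowCongr_apply, Equiv.symm_symm, Equiv.coe_refl, Function.comp_apply, id]
    ring
  have h2 : (k.factorial : R) * (M * N).det = ∑ _σ : Equiv.Perm (Fin k), (M * N).det := by
    simp [Fintype.card_perm]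
  rw [h2, sum_congr rfl fun σ _ => h σ, sum_comm]
  refine sum_congr rfl fun f _ => ?_
  rw [← sum_mul, ← Matrix.det_transpose (M.submatrix id f), Matrix.det_apply' (M.submatrix id f)ᵀ]
  rfl

end CauchyBinet

/-! ### Minors and Gram determinants. -/

section Gram

open Finset Matrix

variable {m k : ℕ}

/-- `k! * det (Wᴴ W)` as a sum of squared moduli of minors. -/
noncomputable def Matrix.minorSq (W : Matrix (Fin m) (Fin k) ℂ) : ℝ :=
  ∑ f : Fin k → Fin m, ‖(W.submatrix f id).det‖ ^ 2

theorem Matrix.minorSq_nonneg (W : Matrix (Fin m) (Fin k) ℂ) : 0 ≤ W.minorSq :=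
  sum_nonneg fun _ _ => by positivity

theorem Matrix.det_conjTranspose_submatrix (P : Matrix (Fin m) (Fin k) ℂ) (f : Fin k → Fin m) :
    (Pᴴ.submatrix id f).det = star (P.submatrix f id).det := by
  rw [← Matrix.det_conjTranspose, Matrix.conjTranspose_submatrix]

theorem Matrix.factorial_mul_det_gram (W : Matrix (Fin m) (Fin k) ℂ) :
    (k.factorial : ℂ) * (Wᴴ * W).det = (W.minorSq : ℂ) := by
  rw [Matrix.factorial_mul_det_mul, Matrix.minorSq, Complex.ofReal_sum]
  refine sum_congr rfl fun f _ => ?_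
  rw [Matrix.det_conjTranspose_submatrix, Complex.star_def, Complex.conj_mul']
  push_cast
  rfl

/-- Cauchy–Binet writes the left side as an inner product of vectors of minors; Cauchy–Schwarz
bounds it. -/
theorem Matrix.norm_factorial_mul_det_sq_le (P Q : Matrix (Fin m) (Fin k) ℂ) :
    ‖(k.factorial : ℂ) * (Pᴴ * Q).det‖ ^ 2 ≤ P.minorSq * Q.minorSq := by
  rw [Matrix.factorial_mul_det_mul]
  refine (pow_le_pow_left₀ (norm_nonneg _) (norm_sum_le _ _) 2).trans ?_
  simp only [Matrix.det_conjTranspose_submatrix, norm_mul, norm_star]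
  exact sum_mul_sq_le_sq_mul_sq _ _ _

/-- Induction on the largest element x: it is at least the number of the other elements, so its
factor is at most the new last factor. -/
theorem prod_finset_le_prod_range {a : ℕ → ℝ} (ha : Antitone a) (ha0 : ∀ i, 0 ≤ a i)
    (s : Finset ℕ) : ∏ i ∈ s, a i ≤ ∏ i ∈ range s.card, a i := by
  induction s using Finset.induction_on_max with
  | empty => simp
  | insert x s hx ih =>
    have hxs : x ∉ s := fun h => lt_irrefl _ (hx x h)
    rw [prod_insert hxs, card_insert_of_notMem hxs, prod_range_succ, mul_comm]
    refine mul_le_mul ih (ha ?_) (ha0 _) (prod_nonneg fun _ _ => ha0 _)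
    have : s ⊆ range x := fun y hy => mem_range.2 (hx y hy)
    simpa using card_le_card this

theorem prod_comp_le_prod_range {a : ℕ → ℝ} (ha : Antitone a) (ha0 : ∀ i, 0 ≤ a i)
    {f : Fin k → Fin m} (hf : Function.Injective f) :
    ∏ i, a (f i) ≤ ∏ i ∈ range k, a i := by
  have hinj : Function.Injective fun i => (f i : ℕ) := Fin.val_injective.comp hf
  have := prod_finset_le_prod_range ha ha0 (univ.image fun i => (f i : ℕ))
  rwa [card_image_of_injective _ hinj, card_univ, Fintype.card_fin,
    prod_image (fun _ _ _ _ h => hinj h)] at this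

theorem Matrix.minorSq_diagonal_mul_le {a : ℕ → ℝ} (ha : Antitone a) (ha0 : ∀ i, 0 ≤ a i)
    (W : Matrix (Fin m) (Fin k) ℂ) :
    (Matrix.diagonal (fun i : Fin m => ((a i : ℝ) : ℂ)) * W).minorSq
      ≤ W.minorSq * (∏ i ∈ range k, a i) ^ 2 := by
  rw [Matrix.minorSq, Matrix.minorSq, sum_mul]
  refine sum_le_sum fun f _ => ?_
  have h : (Matrix.diagonal (fun i : Fin m => ((a i : ℝ) : ℂ)) * W).submatrix f id
      = Matrix.diagonal (fun i => ((a (f i) : ℝ) : ℂ)) * W.submatrix f id := by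
    ext i j
    simp [Matrix.diagonal_mul]
  rw [h, Matrix.det_mul, Matrix.det_diagonal, norm_mul, mul_pow, mul_comm]
  by_cases hf : Function.Injective f
  · refine mul_le_mul_of_nonneg_left ?_ (by positivity)
    rw [← Complex.ofReal_prod, Complex.norm_real, Real.norm_eq_abs, sq_abs]
    exact pow_le_pow_left₀ (prod_nonneg fun _ _ => ha0 _) (prod_comp_le_prod_range ha ha0 hf) 2
  · obtain ⟨i, j, hij, hne⟩ := Function.not_injective_iff.1 hf
    rw [Matrix.det_zero_of_row_eq hne (by ext l; simp [hij])]
    simp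

end Gram

/-! ### Ordered eigenvalues and compressions. -/

section EigSeq

open Finset Matrix

variable {m : ℕ}

/-- `a` lists the eigenvalues of the positive semidefinite matrix `H` in decreasing order (followed
by arbitrary smaller values), and a single unitary diagonalizes all powers of `H`. -/
structure IsEigSeq (H : Matrix (Fin m) (Fin m) ℂ) (a : ℕ → ℝ) : Prop where
  antitone : Antitone a
  nonneg : ∀ i, 0 ≤ a i
  exists_unitary : ∃ U ∈ Matrix.unitaryGroup (Fin m) ℂ, ∀ p : ℝ,
    H ^ p = U * Matrix.diagonal (fun i : Fin m => ((a i ^ p : ℝ) : ℂ)) * star U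

theorem Matrix.IsHermitian.exists_antitone_cfc_eq {H : Matrix (Fin m) (Fin m) ℂ}
    (hH : H.IsHermitian) : ∃ a : Fin m → ℝ, Antitone a ∧ (∀ i, a i ∈ spectrum ℝ H) ∧
      ∃ U ∈ Matrix.unitaryGroup (Fin m) ℂ, ∀ f : ℝ → ℝ,
        cfc f H = U * Matrix.diagonal (fun i => ((f (a i) : ℝ) : ℂ)) * star U := by
  -- `eigenvalues` is the sorted list `eigenvalues₀` reindexed by an arbitrary equivalence; e undoes
  -- that reindexing.
  set e : Fin m ≃ Fin m := (finCongr (Fintype.card_fin m).symm).trans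
    (Fintype.equivOfCardEq (Fintype.card_fin _)) with he
  set U : Matrix (Fin m) (Fin m) ℂ := hH.eigenvectorUnitary.1
  refine ⟨fun i => hH.eigenvalues (e i), ?_, fun i => hH.eigenvalues_mem_spectrum_real _,
    U.submatrix id e, ?_, fun f => ?_⟩
  · intro i j hij
    simp only [Matrix.IsHermitian.eigenvalues, he, Equiv.trans_apply, Equiv.symm_apply_apply]
    exact hH.eigenvalues₀_antitone (by simpa using hij)
  · rw [Matrix.mem_unitaryGroup_iff', Matrix.star_eq_conjTranspose, Matrix.conjTranspose_submatrix,
      ← Matrix.submatrix_mul _ _ _ _ _ Function.bijective_id]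
    have : Uᴴ * U = 1 := Matrix.mem_unitaryGroup_iff'.1 hH.eigenvectorUnitary.2
    rw [this, Matrix.submatrix_one_equiv]
  · rw [hH.cfc_eq, Matrix.IsHermitian.cfc, Unitary.conjStarAlgAut_apply]
    have h1 : Matrix.diagonal (fun i => ((f (hH.eigenvalues (e i)) : ℝ) : ℂ))
        = (Matrix.diagonal (RCLike.ofReal ∘ f ∘ hH.eigenvalues) : Matrix _ _ ℂ).submatrix e e := by
      rw [Matrix.submatrix_diagonal_equiv]
      rfl
    rw [h1, Matrix.star_eq_conjTranspose (U.submatrix id e), Matrix.conjTranspose_submatrix,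
      Matrix.submatrix_mul_equiv, Matrix.submatrix_mul_equiv, Matrix.submatrix_id_id]
    rfl

theorem Matrix.PosSemidef.exists_isEigSeq {H : Matrix (Fin m) (Fin m) ℂ} (hH : H.PosSemidef) :
    ∃ a, IsEigSeq H a := by
  obtain ⟨a, ha, hs, U, hU, hf⟩ := hH.1.exists_antitone_cfc_eq
  have ha0 : ∀ i, 0 ≤ a i := fun i =>
    spectrum_nonneg_of_nonneg (Matrix.nonneg_iff_posSemidef.2 hH) (hs i)
  refine ⟨fun i => if h : i < m then a ⟨i, h⟩ else 0, fun i j hij => ?_, fun i => ?_, U, hU,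
    fun p => ?_⟩
  · split_ifs with h1 h2
    · exact ha hij
    · omega
    · exact ha0 _
    · exact le_rfl
  · split_ifs
    · exact ha0 _
    · exact le_rfl
  · rw [CFC.rpow_eq_cfc_real (Matrix.nonneg_iff_posSemidef.2 hH), hf]
    simp

theorem Matrix.posSemidef_rpow {H : Matrix (Fin m) (Fin m) ℂ} (p : ℝ) : (H ^ p).PosSemidef :=
  Matrix.nonneg_iff_posSemidef.1 CFC.rpow_nonneg

/-- Singular H is allowed, hence the condition on x + y: 0^0 = 1 but 0^x * 0^(-x) = 0 for x ≠ 0. -/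
theorem Matrix.PosSemidef.rpow_add {H : Matrix (Fin m) (Fin m) ℂ} (hH : H.PosSemidef) {x y : ℝ}
    (hxy : x + y ≠ 0) : H ^ (x + y) = H ^ x * H ^ y := by
  obtain ⟨a, ha⟩ := hH.exists_isEigSeq
  obtain ⟨U, hU, h⟩ := ha.exists_unitary
  have hU' : star U * U = 1 := Matrix.mem_unitaryGroup_iff'.1 hU
  rw [h, h, h, show ∀ D E : Matrix (Fin m) (Fin m) ℂ, U * D * star U * (U * E * star U)
    = U * (D * (star U * U) * E) * star U from fun D E => by simp only [mul_assoc], hU', mul_one,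
    Matrix.diagonal_mul_diagonal]
  simp only [← Complex.ofReal_mul, Real.rpow_add' (ha.nonneg _) hxy]

theorem Matrix.isHermitian_rpow (H : Matrix (Fin m) (Fin m) ℂ) (p : ℝ) : (H ^ p)ᴴ = H ^ p :=
  (Matrix.posSemidef_rpow p).1

theorem Matrix.PosSemidef.rpow_rpow {H : Matrix (Fin m) (Fin m) ℂ} (hH : H.PosSemidef) {x y : ℝ}
    (hx : 0 ≤ x) (hy : 0 ≤ y) : (H ^ x) ^ y = H ^ (x * y) :=
  CFC.rpow_rpow_of_exponent_nonneg H x y hx hy (Matrix.nonneg_iff_posSemidef.2 hH)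

theorem IsEigSeq.exists_unitary_eq {H : Matrix (Fin m) (Fin m) ℂ} {a : ℕ → ℝ} (hH : H.PosSemidef)
    (ha : IsEigSeq H a) : ∃ U ∈ Matrix.unitaryGroup (Fin m) ℂ,
      H = U * Matrix.diagonal (fun i : Fin m => ((a i : ℝ) : ℂ)) * star U := by
  obtain ⟨U, hU, h⟩ := ha.exists_unitary
  refine ⟨U, hU, ?_⟩
  have h1 := h 1
  rw [CFC.rpow_one H (Matrix.nonneg_iff_posSemidef.2 hH)] at h1
  simpa using h1

theorem Matrix.trace_unitary_conj {U : Matrix (Fin m) (Fin m) ℂ}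
    (hU : U ∈ Matrix.unitaryGroup (Fin m) ℂ) (D : Matrix (Fin m) (Fin m) ℂ) :
    (U * D * star U).trace = D.trace := by
  rw [Matrix.trace_mul_comm, ← mul_assoc, Matrix.mem_unitaryGroup_iff'.1 hU, one_mul]

theorem IsEigSeq.trace_rpow {H : Matrix (Fin m) (Fin m) ℂ} {a : ℕ → ℝ}
    (ha : IsEigSeq H a) (p : ℝ) : (H ^ p).trace = ((∑ i ∈ range m, a i ^ p : ℝ) : ℂ) := by
  obtain ⟨U, hU, h⟩ := ha.exists_unitary
  rw [h, Matrix.trace_unitary_conj hU, Matrix.trace_diagonal,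
    ← Fin.sum_univ_eq_sum_range (fun i => a i ^ p), Complex.ofReal_sum]

theorem Matrix.minorSq_eq_of_gram_eq {m' k : ℕ} {P : Matrix (Fin m) (Fin k) ℂ}
    {Q : Matrix (Fin m') (Fin k) ℂ}
    (h : Pᴴ * P = Qᴴ * Q) : P.minorSq = Q.minorSq := by
  have := Matrix.factorial_mul_det_gram P
  rw [h, Matrix.factorial_mul_det_gram] at this
  exact_mod_cast this.symm

/-- Up to k! this is det(WᴴHW) ≤ det(WᴴW) ∏ a_i. In an eigenbasis, √H scales each minor by a product
of k values √a_i; only the Gram matrix of P matters. -/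
theorem IsEigSeq.minorSq_le {k : ℕ} {H : Matrix (Fin m) (Fin m) ℂ} {a : ℕ → ℝ} (hH : H.PosSemidef)
    (ha : IsEigSeq H a) {P W : Matrix (Fin m) (Fin k) ℂ} (hP : Pᴴ * P = Wᴴ * H * W) :
    P.minorSq ≤ W.minorSq * ∏ i ∈ range k, a i := by
  obtain ⟨U, hU, h⟩ := ha.exists_unitary_eq hH
  have hU' : U * star U = 1 := Matrix.mem_unitaryGroup_iff.1 hU
  rw [Matrix.star_eq_conjTranspose] at h hU'
  have hsa : Antitone fun i => √(a i) := fun i j hij => Real.sqrt_le_sqrt (ha.antitone hij)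
  have h1 := Matrix.minorSq_diagonal_mul_le hsa (fun i => Real.sqrt_nonneg _) (Uᴴ * W)
  rw [← prod_pow] at h1
  simp only [Real.sq_sqrt (ha.nonneg _)] at h1
  rw [Matrix.minorSq_eq_of_gram_eq (P := Uᴴ * W) (Q := W)] at h1
  · rwa [Matrix.minorSq_eq_of_gram_eq (P := P)]
    rw [hP, h, Matrix.conjTranspose_mul, Matrix.conjTranspose_mul, Matrix.diagonal_conjTranspose,
      Matrix.conjTranspose_conjTranspose]
    have hd : Matrix.diagonal (fun i : Fin m => ((a i : ℝ) : ℂ))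
        = Matrix.diagonal (star fun i : Fin m => ((√(a i) : ℝ) : ℂ))
          * Matrix.diagonal (fun i : Fin m => ((√(a i) : ℝ) : ℂ)) := by
      rw [Matrix.diagonal_mul_diagonal]
      congr 1
      ext i
      simp only [Pi.star_apply, Complex.star_def, Complex.conj_ofReal]
      rw [← Complex.ofReal_mul, Real.mul_self_sqrt (ha.nonneg _)]
    rw [hd]
    simp only [Matrix.mul_assoc]
  · rw [Matrix.conjTranspose_mul, Matrix.conjTranspose_conjTranspose, Matrix.mul_assoc,
      ← Matrix.mul_assoc U, hU', Matrix.one_mul]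

/-- An isometry onto the span of the first `k` eigenvectors. -/
theorem IsEigSeq.exists_isometry {k : ℕ} (hk : k ≤ m) {H : Matrix (Fin m) (Fin m) ℂ} {a : ℕ → ℝ}
    (hH : H.PosSemidef) (ha : IsEigSeq H a) : ∃ V : Matrix (Fin m) (Fin k) ℂ,
      Vᴴ * V = 1 ∧ H * V = V * Matrix.diagonal (fun i : Fin k => ((a i : ℝ) : ℂ)) := by
  obtain ⟨U, hU, h⟩ := ha.exists_unitary_eq hH
  have hU' : Uᴴ * U = 1 := Matrix.mem_unitaryGroup_iff'.1 hU
  rw [Matrix.star_eq_conjTranspose] at h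
  have hHU : H * U = U * Matrix.diagonal (fun i : Fin m => ((a i : ℝ) : ℂ)) := by
    conv_lhs => rw [h]
    rw [Matrix.mul_assoc, hU', Matrix.mul_one]
  refine ⟨U.submatrix id (Fin.castLE hk), ?_, ?_⟩
  · ext i j
    have := congr_fun (congr_fun hU' (Fin.castLE hk i)) (Fin.castLE hk j)
    simp only [Matrix.mul_apply, Matrix.one_apply, Matrix.conjTranspose_apply,
      Matrix.submatrix_apply, id, (Fin.castLE_injective hk).eq_iff] at this ⊢
    exact this
  · ext i j
    have := congr_fun (congr_fun hHU i) (Fin.castLE hk j)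
    rw [Matrix.mul_diagonal] at this ⊢
    simpa [Matrix.mul_apply] using this

end EigSeq

/-! ### Log-convexity of eigenvalue products and the commutation criterion. -/

section ArakiCore

open Finset Matrix

variable {m : ℕ} {A B : Matrix (Fin m) (Fin m) ℂ}

theorem Matrix.PosSemidef.rpow_half_mul_self (hA : A.PosSemidef) (p : ℝ) :
    A ^ (p / 2) * A ^ (p / 2) = A ^ p := by
  rcases eq_or_ne p 0 with rfl | hp
  · rw [zero_div, CFC.rpow_zero A (Matrix.nonneg_iff_posSemidef.2 hA), one_mul]
  · rw [← hA.rpow_add (by simpa using hp), add_halves]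

/-- The matrix `A ^ (p/2) * B ^ p * A ^ (p/2)`. -/
noncomputable def arakiCore (A B : Matrix (Fin m) (Fin m) ℂ) (p : ℝ) : Matrix (Fin m) (Fin m) ℂ :=
  A ^ (p / 2) * B ^ p * A ^ (p / 2)

theorem posSemidef_arakiCore (A B : Matrix (Fin m) (Fin m) ℂ) (p : ℝ) :
    (arakiCore A B p).PosSemidef := by
  have := (Matrix.posSemidef_rpow (H := B) p).mul_mul_conjTranspose_same (A ^ (p / 2))
  rwa [Matrix.isHermitian_rpow] at this

open Classical in
/-- A choice of decreasing eigenvalue sequence of a positive semidefinite matrix. -/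
noncomputable def eigSeq (H : Matrix (Fin m) (Fin m) ℂ) : ℕ → ℝ :=
  if h : ∃ a, IsEigSeq H a then h.choose else 0

theorem Matrix.PosSemidef.isEigSeq_eigSeq (hA : A.PosSemidef) : IsEigSeq A (eigSeq A) := by
  have h := hA.exists_isEigSeq
  rw [eigSeq, dif_pos h]
  exact h.choose_spec

theorem isEigSeq_arakiCore (A B : Matrix (Fin m) (Fin m) ℂ) (p : ℝ) :
    IsEigSeq (arakiCore A B p) (eigSeq (arakiCore A B p)) :=
  (posSemidef_arakiCore A B p).isEigSeq_eigSeq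

theorem gram_rpow_half_mul (hB : B.PosSemidef) (p : ℝ) {k : ℕ} (W : Matrix (Fin m) (Fin k) ℂ) :
    (B ^ (p / 2) * A ^ (p / 2) * W)ᴴ * (B ^ (p / 2) * A ^ (p / 2) * W)
      = Wᴴ * arakiCore A B p * W := by
  simp only [Matrix.conjTranspose_mul, Matrix.isHermitian_rpow, arakiCore,
    ← hB.rpow_half_mul_self p, Matrix.mul_assoc]

/-- Cauchy–Schwarz for minors is applied to B^(s/2)A^(s/2)W and B^(t/2)A^(t/2)W. Their cross Gram
matrix is WᴴW times the top eigenvalues at the midpoint, and det(WᴴW) cancels. -/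
theorem prod_eigSeq_arakiCore_midpoint_of_lt (hA : A.PosSemidef) (hB : B.PosSemidef) {k : ℕ}
    (hk : k ≤ m) {s t : ℝ} (ht : 0 ≤ t) (hts : t < s) :
    (∏ i ∈ range k, eigSeq (arakiCore A B ((s + t) / 2)) i) ^ 2 ≤
      (∏ i ∈ range k, eigSeq (arakiCore A B s) i) *
        ∏ i ∈ range k, eigSeq (arakiCore A B t) i := by
  set a := eigSeq (arakiCore A B ((s + t) / 2)) with ha
  have hs := isEigSeq_arakiCore A B s
  have ht' := isEigSeq_arakiCore A B t
  have hr : IsEigSeq (arakiCore A B ((s + t) / 2)) a := isEigSeq_arakiCore A B _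
  obtain ⟨V, hV1, hV⟩ := hr.exists_isometry hk (posSemidef_arakiCore A B _)
  set L := Matrix.diagonal (fun i : Fin k => ((a i : ℝ) : ℂ)) with hL
  have hLdet : L.det = ((∏ i ∈ range k, a i : ℝ) : ℂ) := by
    rw [hL, Matrix.det_diagonal, ← Fin.prod_univ_eq_prod_range a, Complex.ofReal_prod]
  -- The exponent balances the two sides: t/2 + (s-t)/4 = s/2 - (s-t)/4 = (s+t)/4.
  set W := A ^ ((s - t) / 4) * V with hW
  have h1 : A ^ (t / 2) * A ^ ((s - t) / 4) = A ^ ((s + t) / 2 / 2) := by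
    rw [← hA.rpow_add (by linarith)]; congr 1; ring
  have h2 : A ^ (s / 2) = A ^ ((s - t) / 4) * A ^ ((s + t) / 2 / 2) := by
    rw [← hA.rpow_add (by linarith)]; congr 1; ring
  have h3 : B ^ (s / 2) * B ^ (t / 2) = B ^ ((s + t) / 2) := by
    rw [← hB.rpow_add (by linarith)]; congr 1; ring
  have hZ : (B ^ (s / 2) * A ^ (s / 2) * W)ᴴ * (B ^ (t / 2) * A ^ (t / 2) * W) = Wᴴ * W * L := by
    calc _ = Wᴴ * (A ^ (s / 2) * ((B ^ (s / 2) * B ^ (t / 2)) *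
            ((A ^ (t / 2) * A ^ ((s - t) / 4)) * V))) := by
          simp only [Matrix.conjTranspose_mul, Matrix.isHermitian_rpow, Matrix.mul_assoc, hW]
      _ = Wᴴ * (A ^ ((s - t) / 4) * (arakiCore A B ((s + t) / 2) * V)) := by
          rw [h1, h2, h3, arakiCore]
          simp only [Matrix.mul_assoc]
      _ = _ := by rw [hV, hW]; simp only [Matrix.mul_assoc]
  have key := Matrix.norm_factorial_mul_det_sq_le (B ^ (s / 2) * A ^ (s / 2) * W)
    (B ^ (t / 2) * A ^ (t / 2) * W)
  rw [hZ, Matrix.det_mul, ← mul_assoc, Matrix.factorial_mul_det_gram, hLdet, ← Complex.ofReal_mul,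
    Complex.norm_real, Real.norm_eq_abs, sq_abs] at key
  have hP := hs.minorSq_le (posSemidef_arakiCore A B _) (gram_rpow_half_mul (A := A) hB s W)
  have hQ := ht'.minorSq_le (posSemidef_arakiCore A B _) (gram_rpow_half_mul (A := A) hB t W)
  have hPQ := mul_le_mul hP hQ (Matrix.minorSq_nonneg _)
    ((Matrix.minorSq_nonneg _).trans hP)
  rcases (Matrix.minorSq_nonneg W).eq_or_lt with h0 | h0
  · have hdet : (Wᴴ * W).det = 0 := by
      have := Matrix.factorial_mul_det_gram W
      rw [← h0, Complex.ofReal_zero, mul_eq_zero] at this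
      exact this.resolve_left (Nat.cast_ne_zero.2 k.factorial_ne_zero)
    -- Nothing can be cancelled here, but W kills a vector v and L has W as a right factor, so det L
    -- = 0 and the left side vanishes.
    obtain ⟨v, hv0, hv⟩ := Matrix.exists_mulVec_eq_zero_iff.2 hdet
    rw [Matrix.conjTranspose_mul_self_mulVec_eq_zero] at hv
    have h4 : A ^ ((s + t) / 2 / 2) = A ^ ((s + t) / 2 / 2 - (s - t) / 4) * A ^ ((s - t) / 4) := by
      rw [← hA.rpow_add (by linarith)]; congr 1; ring
    have h5 : L = Vᴴ * (A ^ ((s + t) / 2 / 2) * B ^ ((s + t) / 2) *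
        A ^ ((s + t) / 2 / 2 - (s - t) / 4)) * W := by
      rw [← Matrix.one_mul L, ← hV1, Matrix.mul_assoc, ← hV, arakiCore]
      nth_rewrite 2 [h4]
      simp only [hW, Matrix.mul_assoc]
    have h6 : L.det = 0 := Matrix.exists_mulVec_eq_zero_iff.1
      ⟨v, hv0, by rw [h5, ← Matrix.mulVec_mulVec, hv, Matrix.mulVec_zero]⟩
    rw [hLdet, Complex.ofReal_eq_zero] at h6
    rw [h6, zero_pow two_ne_zero]
    exact mul_nonneg (prod_nonneg fun _ _ => hs.nonneg _) (prod_nonneg fun _ _ => ht'.nonneg _)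
  · have h7 := key.trans hPQ
    refine le_of_mul_le_mul_left ?_ (mul_pos h0 h0)
    calc _ = _ := by ring
      _ ≤ _ := h7
      _ = _ := by ring

theorem prod_eigSeq_arakiCore_midpoint (hA : A.PosSemidef) (hB : B.PosSemidef) {k : ℕ}
    (hk : k ≤ m) {s t : ℝ} (hs : 0 ≤ s) (ht : 0 ≤ t) :
    (∏ i ∈ range k, eigSeq (arakiCore A B ((s + t) / 2)) i) ^ 2 ≤
      (∏ i ∈ range k, eigSeq (arakiCore A B s) i) *
        ∏ i ∈ range k, eigSeq (arakiCore A B t) i := by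
  rcases lt_trichotomy s t with h | rfl | h
  · rw [add_comm, mul_comm]
    exact prod_eigSeq_arakiCore_midpoint_of_lt hA hB hk hs h
  · rw [add_self_div_two, sq]
  · exact prod_eigSeq_arakiCore_midpoint_of_lt hA hB hk ht h

theorem IsEigSeq.trace_eq {H : Matrix (Fin m) (Fin m) ℂ} {a : ℕ → ℝ} (hH : H.PosSemidef)
    (ha : IsEigSeq H a) : H.trace = ((∑ i ∈ range m, a i : ℝ) : ℂ) := by
  have := ha.trace_rpow 1
  rw [CFC.rpow_one H (Matrix.nonneg_iff_posSemidef.2 hH)] at this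
  simpa using this

theorem prod_eigSeq_arakiCore_zero (hA : A.PosSemidef) (hB : B.PosSemidef) {k : ℕ} (hk : k ≤ m) :
    ∏ i ∈ range k, eigSeq (arakiCore A B 0) i = 1 := by
  have h1 : arakiCore A B 0 = 1 := by
    simp [arakiCore, CFC.rpow_zero A (Matrix.nonneg_iff_posSemidef.2 hA),
      CFC.rpow_zero B (Matrix.nonneg_iff_posSemidef.2 hB)]
  obtain ⟨V, hV1, hV⟩ := (isEigSeq_arakiCore A B 0).exists_isometry hk (posSemidef_arakiCore A B _)
  set a := eigSeq (arakiCore A B 0)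
  have h2 := congr_arg (fun X => (Vᴴ * X).det) hV
  simp only [h1, Matrix.one_mul, ← Matrix.mul_assoc, hV1, Matrix.det_one, Matrix.det_diagonal] at h2
  rw [← Fin.prod_univ_eq_prod_range a]
  exact_mod_cast h2.symm

theorem Matrix.PosSemidef.trace_mul_nonneg (hA : A.PosSemidef) (hB : B.PosSemidef) :
    0 ≤ (A * B).trace := by
  have h := hA.rpow_half_mul_self 1
  rw [CFC.rpow_one A (Matrix.nonneg_iff_posSemidef.2 hA)] at h
  have h2 := (hB.mul_mul_conjTranspose_same (A ^ ((1 : ℝ) / 2))).trace_nonneg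
  rwa [Matrix.isHermitian_rpow, Matrix.trace_mul_comm, ← Matrix.mul_assoc, h] at h2

theorem Matrix.PosSemidef.rpow_le_one_add_rpow (hA : A.PosSemidef) {p q : ℝ} (hp : 0 ≤ p)
    (hpq : p ≤ q) : (1 + A ^ q - A ^ p).PosSemidef := by
  obtain ⟨U, hU, h⟩ := hA.isEigSeq_eigSeq.exists_unitary
  have ha := hA.isEigSeq_eigSeq
  set a := eigSeq A
  have h1 : (1 : Matrix (Fin m) (Fin m) ℂ) = U * Matrix.diagonal (fun _ => (1 : ℂ)) * star U := by
    rw [Matrix.diagonal_one, mul_one, Matrix.mem_unitaryGroup_iff.1 hU]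
  rw [h, h, h1, ← add_mul, ← mul_add, ← sub_mul, ← mul_sub, Matrix.diagonal_add,
    Matrix.diagonal_sub]
  refine (Matrix.PosSemidef.diagonal fun i => ?_).mul_mul_conjTranspose_same U
  have hx := ha.nonneg i
  have : a i ^ p ≤ 1 + a i ^ q := by
    rcases le_total (a i) 1 with h | h
    · linarith [Real.rpow_le_one hx h hp, Real.rpow_nonneg hx q]
    · linarith [Real.rpow_le_rpow_of_exponent_le h hpq]
  have h2 : (0 : ℝ) ≤ 1 + a i ^ q - a i ^ p := by linarith
  rw [Pi.zero_apply]
  simpa only [Complex.ofReal_sub, Complex.ofReal_add, Complex.ofReal_one] using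
    Complex.zero_le_real.2 h2

/-- Supplies the bound that midpoint convexity needs. Each eigenvalue is at most the trace, and x^p
≤ 1 + x^q removes p from it. -/
theorem exists_prod_eigSeq_arakiCore_le (hA : A.PosSemidef) (hB : B.PosSemidef) {k : ℕ}
    (hk : k ≤ m) (q : ℝ) :
    ∃ M, ∀ p ∈ Set.Icc 0 q, ∏ i ∈ range k, eigSeq (arakiCore A B p) i ≤ M := by
  refine ⟨(((1 + A ^ q) * (1 + B ^ q)).trace.re) ^ k, fun p hp => ?_⟩
  have ha := isEigSeq_arakiCore A B p
  have htr := ha.trace_eq (posSemidef_arakiCore A B p)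
  have h1 : (arakiCore A B p).trace = (A ^ p * B ^ p).trace := by
    rw [arakiCore, Matrix.trace_mul_comm, ← Matrix.mul_assoc, hA.rpow_half_mul_self]
  have h2 : (A ^ p * B ^ p).trace ≤ ((1 + A ^ q) * (1 + B ^ q)).trace := by
    have e1 := (hA.rpow_le_one_add_rpow hp.1 hp.2).trace_mul_nonneg
      (Matrix.posSemidef_rpow (H := B) p)
    have e2 := (Matrix.PosSemidef.one.add (Matrix.posSemidef_rpow (H := A) q)).trace_mul_nonneg
      (hB.rpow_le_one_add_rpow hp.1 hp.2)
    rw [Matrix.sub_mul, Matrix.trace_sub] at e1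
    rw [Matrix.mul_sub, Matrix.trace_sub] at e2
    exact (sub_nonneg.1 e1).trans (sub_nonneg.1 e2)
  set a := eigSeq (arakiCore A B p)
  have h3 : ∑ i ∈ range m, a i ≤ ((1 + A ^ q) * (1 + B ^ q)).trace.re := by
    rw [← h1, htr] at h2
    simpa using (Complex.le_def.1 h2).1
  calc ∏ i ∈ range k, a i ≤ ∏ _i ∈ range k, ((1 + A ^ q) * (1 + B ^ q)).trace.re :=
        prod_le_prod (fun i _ => ha.nonneg i) fun i hi =>
          (single_le_sum (fun j _ => ha.nonneg j)
            (mem_range.2 ((mem_range.1 hi).trans_le hk))).trans h3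
    _ = _ := by simp

theorem prod_eigSeq_arakiCore_le_rpow (hA : A.PosSemidef) (hB : B.PosSemidef) {k : ℕ}
    (hk : k ≤ m) {p q : ℝ} (hp : 0 < p) (hpq : p < q) :
    ∏ i ∈ range k, eigSeq (arakiCore A B p) i
      ≤ (∏ i ∈ range k, eigSeq (arakiCore A B q) i) ^ (p / q) := by
  obtain ⟨M, hM⟩ := exists_prod_eigSeq_arakiCore_le hA hB hk q
  exact le_rpow_div_of_midpoint
    (g := fun p => ∏ i ∈ range k, eigSeq (arakiCore A B p) i)
    (fun x _ => prod_nonneg fun _ _ => (isEigSeq_arakiCore A B x).nonneg _) hM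
    (fun x hx y hy => prod_eigSeq_arakiCore_midpoint hA hB hk hx.1 hy.1)
    (prod_eigSeq_arakiCore_zero hA hB hk) hp hpq le_rfl

theorem prod_eigSeq_arakiCore_le_sq_half (hA : A.PosSemidef) (hB : B.PosSemidef) {k : ℕ}
    (hk : k ≤ m) {p q : ℝ} (hp : 0 < p) (hpq : p < q)
    (heq : ∏ i ∈ range k, eigSeq (arakiCore A B p) i
      = (∏ i ∈ range k, eigSeq (arakiCore A B q) i) ^ (p / q)) :
    ∏ i ∈ range k, eigSeq (arakiCore A B q) i
      ≤ (∏ i ∈ range k, eigSeq (arakiCore A B (q / 2)) i) ^ 2 := by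
  obtain ⟨M, hM⟩ := exists_prod_eigSeq_arakiCore_le hA hB hk q
  exact le_sq_half_of_midpoint
    (g := fun p => ∏ i ∈ range k, eigSeq (arakiCore A B p) i)
    (fun x _ => prod_nonneg fun _ _ => (isEigSeq_arakiCore A B x).nonneg _) hM
    (fun x hx y hy => prod_eigSeq_arakiCore_midpoint hA hB hk hx.1 hy.1)
    (prod_eigSeq_arakiCore_zero hA hB hk) hp hpq heq

/-- Araki's log-majorization for the eigenvalues of `arakiMean`. -/
theorem prod_eigSeq_rpow_le (hA : A.PosSemidef) (hB : B.PosSemidef) {k : ℕ}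
    (hk : k ≤ m) {p q : ℝ} (hp : 0 < p) (hpq : p < q) :
    ∏ i ∈ range k, eigSeq (arakiCore A B p) i ^ (1 / p)
      ≤ ∏ i ∈ range k, eigSeq (arakiCore A B q) i ^ (1 / q) := by
  have hp' := isEigSeq_arakiCore A B p
  have hq' := isEigSeq_arakiCore A B q
  rw [Real.finsetProd_rpow _ _ fun i _ => hp'.nonneg i,
    Real.finsetProd_rpow _ _ fun i _ => hq'.nonneg i]
  have h := Real.rpow_le_rpow (prod_nonneg fun i _ => hp'.nonneg i)
    (prod_eigSeq_arakiCore_le_rpow hA hB hk hp hpq) (one_div_nonneg.2 hp.le)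
  rwa [← Real.rpow_mul (prod_nonneg fun i _ => hq'.nonneg i),
    show p / q * (1 / p) = 1 / q by field_simp] at h

/-- If `Tr E² D² = Tr (E D)²` for Hermitian `E`, `D`, then they commute. -/
theorem commute_of_trace_eq {E D : Matrix (Fin m) (Fin m) ℂ} (hE : Eᴴ = E) (hD : Dᴴ = D)
    (h : (E * E * (D * D)).trace = (E * D * (E * D)).trace) : E * D = D * E := by
  -- The squared Hilbert–Schmidt norm of ED - DE is 2(Tr E²D² - Tr (ED)²).
  rw [← sub_eq_zero, ← Matrix.trace_conjTranspose_mul_self_eq_zero_iff]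
  rw [Matrix.conjTranspose_sub, Matrix.conjTranspose_mul, Matrix.conjTranspose_mul, hE, hD,
    Matrix.sub_mul, Matrix.mul_sub, Matrix.mul_sub, Matrix.trace_sub, Matrix.trace_sub,
    Matrix.trace_sub]
  have h1 : (D * E * (E * D)).trace = (E * E * (D * D)).trace := by
    rw [Matrix.mul_assoc, Matrix.trace_mul_comm]; simp only [Matrix.mul_assoc]
  have h2 : (E * D * (D * E)).trace = (E * E * (D * D)).trace := by
    rw [← Matrix.mul_assoc, Matrix.trace_mul_comm]; simp only [Matrix.mul_assoc]
  have h3 : (D * E * (D * E)).trace = (E * D * (E * D)).trace := by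
    rw [Matrix.mul_assoc, Matrix.trace_mul_comm]; simp only [Matrix.mul_assoc]
  rw [h1, h2, h3, h]
  ring

theorem trace_arakiCore_sq_half (hA : A.PosSemidef) (hB : B.PosSemidef) (q : ℝ) :
    (arakiCore A B q).trace = (A ^ (q / 2) * A ^ (q / 2) * (B ^ (q / 2) * B ^ (q / 2))).trace ∧
    (arakiCore A B (q / 2) ^ (2 : ℝ)).trace
      = (A ^ (q / 2) * B ^ (q / 2) * (A ^ (q / 2) * B ^ (q / 2))).trace := by
  constructor
  · rw [arakiCore, Matrix.trace_mul_comm, ← Matrix.mul_assoc, hB.rpow_half_mul_self]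
  · have h2 : arakiCore A B (q / 2) ^ (2 : ℝ) = arakiCore A B (q / 2) * arakiCore A B (q / 2) := by
      rw [← sq, ← CFC.rpow_natCast _ 2
        (Matrix.nonneg_iff_posSemidef.2 (posSemidef_arakiCore A B _)), Nat.cast_ofNat]
    rw [h2, arakiCore, ← hA.rpow_half_mul_self (q / 2), Matrix.mul_assoc, Matrix.trace_mul_comm]
    simp only [Matrix.mul_assoc]

/-- A is the (1/r)-th power of A^r, and functional calculus preserves commutation; likewise for B.
-/
theorem Matrix.PosSemidef.commute_of_rpow (hA : A.PosSemidef) (hB : B.PosSemidef) {r : ℝ}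
    (hr : 0 < r) (h : A ^ r * B ^ r = B ^ r * A ^ r) : A * B = B * A := by
  have h1 : ∀ {H : Matrix (Fin m) (Fin m) ℂ}, H.PosSemidef → (H ^ r) ^ (1 / r) = H := fun hH => by
    rw [hH.rpow_rpow hr.le (by positivity), mul_one_div_cancel hr.ne',
      CFC.rpow_one _ (Matrix.nonneg_iff_posSemidef.2 hH)]
  have h2 : Commute (A ^ r) (B ^ r) := h
  have h3 : Commute ((A ^ r) ^ (1 / r)) (B ^ r) := by
    rw [CFC.rpow_def]
    exact h2.cfc_nnreal _
  have h4 : Commute ((B ^ r) ^ (1 / r)) ((A ^ r) ^ (1 / r)) := by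
    rw [CFC.rpow_def (a := B ^ r)]
    exact h3.symm.cfc_nnreal _
  rw [h1 hA, h1 hB] at h4
  exact h4.symm

end ArakiCore

/-! ### Unitarily invariant norms, supporting weights and the equality case. -/

section UnitarilyInvariant

open Finset Matrix

variable {m : ℕ} {N : Seminorm ℂ (Matrix (Fin m) (Fin m) ℂ)}

/-- The diagonal matrix with the given real entries. -/
noncomputable abbrev realDiagonal (x : Fin m → ℝ) : Matrix (Fin m) (Fin m) ℂ :=
  Matrix.diagonal fun i => ((x i : ℝ) : ℂ)

theorem IsUnitarilyInvariantNorm.unitary_conj (hN : IsUnitarilyInvariantNorm N)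
    {U : Matrix (Fin m) (Fin m) ℂ} (hU : U ∈ Matrix.unitaryGroup (Fin m) ℂ)
    (X : Matrix (Fin m) (Fin m) ℂ) : N (U * X * star U) = N X :=
  hN.unitary_invariant U hU _ (Unitary.star_mem hU) X

theorem IsUnitarilyInvariantNorm.realDiagonal_comp_perm (hN : IsUnitarilyInvariantNorm N)
    (σ : Equiv.Perm (Fin m)) (x : Fin m → ℝ) : N (realDiagonal (x ∘ σ)) = N (realDiagonal x) := by
  set P : Matrix (Fin m) (Fin m) ℂ := (1 : Matrix (Fin m) (Fin m) ℂ).submatrix σ id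
  have hPs : star P = (1 : Matrix (Fin m) (Fin m) ℂ).submatrix id σ := by
    rw [Matrix.star_eq_conjTranspose, Matrix.conjTranspose_submatrix, Matrix.conjTranspose_one]
  have hP : P ∈ Matrix.unitaryGroup (Fin m) ℂ := by
    rw [Matrix.mem_unitaryGroup_iff, hPs, ← Matrix.submatrix_mul _ _ _ _ _ Function.bijective_id,
      Matrix.one_mul, Matrix.submatrix_one_equiv]
  rw [← hN.unitary_conj hP (realDiagonal x), hPs]
  congr 1
  ext i j
  rcases eq_or_ne i j with rfl | h <;>
    simp [P, Matrix.mul_apply, Matrix.diagonal_apply, Matrix.one_apply, *]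

theorem IsUnitarilyInvariantNorm.realDiagonal_mul_sign (hN : IsUnitarilyInvariantNorm N)
    {e : Fin m → ℝ} (he : ∀ i, e i * e i = 1) (x : Fin m → ℝ) :
    N (realDiagonal fun i => e i * x i) = N (realDiagonal x) := by
  have hD : realDiagonal e ∈ Matrix.unitaryGroup (Fin m) ℂ := by
    rw [Matrix.mem_unitaryGroup_iff, Matrix.star_eq_conjTranspose, Matrix.diagonal_conjTranspose,
      Matrix.diagonal_mul_diagonal, ← Matrix.diagonal_one]
    congr 1
    ext i
    simp only [Pi.star_apply, Complex.star_def, Complex.conj_ofReal]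
    exact_mod_cast he i
  rw [← hN.unitary_invariant _ hD 1 (one_mem _) (realDiagonal x), mul_one,
    Matrix.diagonal_mul_diagonal]
  simp only [realDiagonal, Complex.ofReal_mul]

theorem realDiagonal_add (x y : Fin m → ℝ) :
    realDiagonal (x + y) = realDiagonal x + realDiagonal y := by
  ext i j
  rcases eq_or_ne i j with rfl | h <;> simp [*]

theorem realDiagonal_smul (c : ℝ) (x : Fin m → ℝ) :
    realDiagonal (c • x) = (c : ℂ) • realDiagonal x := by
  rw [realDiagonal, realDiagonal, ← Matrix.diagonal_smul]
  congr 1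
  ext i
  simp

/-- Supporting functional of the gauge function at a real vector. -/
theorem Seminorm.exists_support_realDiagonal (N : Seminorm ℂ (Matrix (Fin m) (Fin m) ℂ))
    (a : Fin m → ℝ) : ∃ y : Fin m → ℝ, ∑ i, y i * a i = N (realDiagonal a) ∧
      ∀ x : Fin m → ℝ, ∑ i, y i * x i ≤ N (realDiagonal x) := by
  rcases eq_or_ne a 0 with rfl | ha
  · refine ⟨0, ?_, fun x => by simp⟩
    have : realDiagonal (0 : Fin m → ℝ) = 0 := by
      ext i j
      simp [Matrix.diagonal_apply]
    rw [this, map_zero]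
    simp
  -- Hahn–Banach extends c • a ↦ c N(a) from the line through a.
  obtain ⟨g, hg, hgN⟩ := exists_extension_of_le_sublinear
    (LinearPMap.mkSpanSingleton (K := ℝ) a (N (realDiagonal a)) ha)
    (fun x => N (realDiagonal x))
    (fun c hc x => by
      rw [realDiagonal_smul, map_smul_eq_mul, Complex.norm_real, Real.norm_eq_abs, abs_of_pos hc])
    (fun x y => by rw [realDiagonal_add]; exact map_add_le_add N _ _)
    (by
      rintro ⟨x, hx⟩
      obtain ⟨c, rfl⟩ := Submodule.mem_span_singleton.1 hx
      rw [realDiagonal_smul, map_smul_eq_mul,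
        Complex.norm_real, Real.norm_eq_abs]
      exact (LinearPMap.mkSpanSingleton'_apply (σ := RingHom.id ℝ) a (N (realDiagonal a)) _ c hx).trans_le
        (mul_le_mul_of_nonneg_right (le_abs_self c) (apply_nonneg N _)))
  have hsum : ∀ x : Fin m → ℝ, ∑ i, g (Pi.single i 1) * x i = g x := fun x => by
    rw [LinearMap.pi_apply_eq_sum_univ g x]
    refine sum_congr rfl fun i _ => ?_
    rw [smul_eq_mul, mul_comm]
    congr 2
    ext j
    simp [Pi.single_apply, eq_comm]
  refine ⟨fun i => g (Pi.single i 1), ?_, fun x => (hsum x).trans_le (hgN x)⟩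
  have := hg ⟨a, Submodule.mem_span_singleton_self a⟩
  rw [LinearPMap.mkSpanSingleton_apply] at this
  rw [hsum]
  exact this

/-- Take absolute values of a supporting functional and sort them. Sign and permutation invariance
keep it dominated by N; the rearrangement inequality keeps its value at a. -/
theorem IsUnitarilyInvariantNorm.exists_antitone_support (hN : IsUnitarilyInvariantNorm N)
    {a : Fin m → ℝ} (ha : Antitone a) (ha0 : ∀ i, 0 ≤ a i) :
    ∃ c : Fin m → ℝ, Antitone c ∧ (∀ i, 0 ≤ c i) ∧ ∑ i, c i * a i = N (realDiagonal a) ∧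
      ∀ x : Fin m → ℝ, ∑ i, c i * x i ≤ N (realDiagonal x) := by
  obtain ⟨y, hya, hyN⟩ := N.exists_support_realDiagonal a
  set σ := Tuple.sort (fun i => -|y i|)
  have hσ : Antitone fun i => |y (σ i)| := fun i j hij =>
    neg_le_neg_iff.1 (Tuple.monotone_sort (fun i => -|y i|) hij)
  have hx : ∀ x : Fin m → ℝ, ∑ i, |y (σ i)| * x i ≤ N (realDiagonal x) := fun x => by
    set e : Fin m → ℝ := fun i => if 0 ≤ y i then 1 else -1
    have he : ∀ i, |y i| = y i * e i := fun i => by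
      simp only [e]
      split_ifs with h
      · rw [abs_of_nonneg h, mul_one]
      · rw [abs_of_neg (not_le.1 h), mul_neg_one]
    have he2 : ∀ i, e i * e i = 1 := fun i => by
      simp only [e]
      split_ifs <;> norm_num
    rw [← hN.realDiagonal_comp_perm σ.symm x, ← hN.realDiagonal_mul_sign he2]
    refine le_trans (le_of_eq ?_) (hyN _)
    rw [← Equiv.sum_comp σ fun i => y i * _]
    refine sum_congr rfl fun i _ => ?_
    rw [he]
    simp only [Function.comp_apply, Equiv.symm_apply_apply, mul_assoc]
  refine ⟨fun i => |y (σ i)|, hσ, fun i => abs_nonneg _, le_antisymm (hx a) ?_, hx⟩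
  have hmono : Monovary (fun i => |y (σ i)|) a := hσ.monovary ha
  have h1 := hmono.sum_comp_perm_mul_le_sum_mul (σ := σ.symm)
  simp only [Equiv.apply_symm_apply] at h1
  rw [← hya]
  exact (sum_le_sum fun i _ => mul_le_mul_of_nonneg_right (le_abs_self _) (ha0 i)).trans h1

theorem IsStrictlyIncreasingNorm.eq_of_realDiagonal (hs : IsStrictlyIncreasingNorm N)
    {a b : Fin m → ℝ} (ha0 : ∀ i, 0 ≤ a i) (hab : ∀ i, a i ≤ b i)
    (h : N (realDiagonal a) = N (realDiagonal b)) : a = b := by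
  have hpos : ∀ {x : Fin m → ℝ}, (∀ i, 0 ≤ x i) → (realDiagonal x).PosSemidef := fun hx =>
    Matrix.PosSemidef.diagonal fun i => Complex.zero_le_real.2 (hx i)
  have hle : realDiagonal a ≤ realDiagonal b := by
    rw [Matrix.le_iff]
    have := hpos (x := b - a) fun i => sub_nonneg.2 (hab i)
    simpa [realDiagonal, Matrix.diagonal_sub] using this
  have := hs _ _ (hpos ha0) (hpos fun i => (ha0 i).trans (hab i)) hle h
  ext i
  have h2 := congr_fun (Matrix.diagonal_injective this) i
  exact_mod_cast h2

/-- The updated vector is the average of a and its sign flip at i. -/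
theorem IsUnitarilyInvariantNorm.realDiagonal_update_zero_le (hN : IsUnitarilyInvariantNorm N)
    (a : Fin m → ℝ) (i : Fin m) :
    N (realDiagonal (Function.update a i 0)) ≤ N (realDiagonal a) := by
  set e : Fin m → ℝ := Function.update 1 i (-1)
  have he : ∀ j, e j * e j = 1 := fun j => by
    rcases eq_or_ne j i with rfl | h <;> simp [e, *]
  have h1 : realDiagonal (Function.update a i 0)
      = (((1 / 2 : ℝ)) : ℂ) • realDiagonal (a + fun j => e j * a j) := by
    rw [← realDiagonal_smul]
    congr 1
    ext j
    rcases eq_or_ne j i with rfl | h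
    · simp [e]
    · simp only [ne_eq, h, not_false_eq_true, Function.update_of_ne, Pi.smul_apply, Pi.add_apply,
        Pi.one_apply, one_mul, smul_eq_mul, e]
      ring
  rw [h1, map_smul_eq_mul, realDiagonal_add, Complex.norm_real]
  have h2 := map_add_le_add N (realDiagonal a) (realDiagonal fun j => e j * a j)
  rw [hN.realDiagonal_mul_sign he] at h2
  norm_num at h2 ⊢
  linarith

/-- Weak log-majorization implies domination for unitarily invariant norms. -/
theorem IsUnitarilyInvariantNorm.realDiagonal_le_of_prod_le (hN : IsUnitarilyInvariantNorm N)
    {a b : ℕ → ℝ} (ha : Antitone a) (ha0 : ∀ i, 0 ≤ a i) (hb0 : ∀ i, 0 ≤ b i)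
    (h : ∀ k ≤ m, ∏ i ∈ range k, a i ≤ ∏ i ∈ range k, b i) :
    N (realDiagonal fun i : Fin m => a i) ≤ N (realDiagonal fun i : Fin m => b i) ∧
    (IsStrictlyIncreasingNorm N →
      N (realDiagonal fun i : Fin m => a i) = N (realDiagonal fun i : Fin m => b i) →
      ∀ i < m, a i = b i) := by
  obtain ⟨c, hc, hc0, hca, hcN⟩ := hN.exists_antitone_support (a := fun i : Fin m => a i)
    (fun i j hij => ha hij) (fun i => ha0 i)
  set c' : ℕ → ℝ := fun i => if h : i < m then c ⟨i, h⟩ else 0 with hc'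
  have hc'c : ∀ i : Fin m, c' i = c i := fun i => by simp [hc']
  have hc'0 : ∀ i, 0 ≤ c' i := fun i => by
    simp only [hc']
    split_ifs
    · exact hc0 _
    · exact le_rfl
  have hc'a : Antitone c' := fun i j hij => by
    simp only [hc']
    split_ifs with h1 h2
    · exact hc hij
    · omega
    · exact hc0 _
    · exact le_rfl
  have hsum : ∀ x : ℕ → ℝ, ∑ i ∈ range m, c' i * x i = ∑ i : Fin m, c i * x i := fun x => by
    rw [← Fin.sum_univ_eq_sum_range (fun i => c' i * x i)]
    simp only [hc'c]
  obtain ⟨hle, heq⟩ := sum_mul_le_sum_mul_of_prod_le ha ha0 hb0 hc'a hc'0 h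
  rw [hsum, hsum, hca] at hle heq
  refine ⟨hle.trans (hcN _), fun hs hNeq => ?_⟩
  have heq' := heq (le_antisymm hle (hNeq ▸ hcN _))
  -- If c_i = 0, erasing a_i leaves the pairing unchanged, hence does not lower the norm,
  -- contradicting strictness.
  have hcpos : ∀ i : Fin m, 0 < a i → 0 < c i := fun i hi => by
    refine lt_of_le_of_ne (hc0 i) fun hci => ?_
    have h1 : N (realDiagonal fun i : Fin m => a i) ≤
        N (realDiagonal (Function.update (fun i : Fin m => a i) i 0)) := by
      rw [← hca]
      refine le_trans (le_of_eq (sum_congr rfl fun j _ => ?_)) (hcN _)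
      rcases eq_or_ne j i with rfl | hj
      · rw [← hci, zero_mul, zero_mul]
      · rw [Function.update_of_ne hj]
    have h2 := hs.eq_of_realDiagonal (a := Function.update (fun i : Fin m => a i) i 0)
      (b := fun i : Fin m => a i)
      (fun j => by
        rcases eq_or_ne j i with rfl | hj
        · rw [Function.update_self]
        · rw [Function.update_of_ne hj]
          exact ha0 j)
      (fun j => by
        rcases eq_or_ne j i with rfl | hj
        · rw [Function.update_self]
          exact hi.le
        · rw [Function.update_of_ne hj])
      (le_antisymm (hN.realDiagonal_update_zero_le _ i) h1)
    have h3 := congr_fun h2 i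
    simp only [Function.update_self] at h3
    exact hi.ne h3
  have hpos : ∀ i : Fin m, 0 < a i → a i = b i := fun i hi =>
    heq' i i.2 (by rw [hc'c]; exact hcpos i hi) hi
  -- Where a_i = 0 only a_i ≤ b_i is known so far; strictness is used again to get equality there.
  have hab := hs.eq_of_realDiagonal (a := fun i : Fin m => a i) (b := fun i : Fin m => b i)
    (fun i => ha0 i) (fun i => by
      rcases (ha0 i).eq_or_lt with h0 | h0
      · rw [← h0]; exact hb0 i
      · exact (hpos i h0).le) hNeq
  exact fun i hi => congr_fun hab ⟨i, hi⟩

theorem IsUnitarilyInvariantNorm.arakiMean_eq (hN : IsUnitarilyInvariantNorm N)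
    (A B : Matrix (Fin m) (Fin m) ℂ) (p : ℝ) : N (arakiMean A B p)
      = N (realDiagonal fun i : Fin m => eigSeq (arakiCore A B p) i ^ (1 / p)) := by
  obtain ⟨U, hU, h⟩ := (isEigSeq_arakiCore A B p).exists_unitary
  rw [arakiMean, ← arakiCore, h, hN.unitary_conj hU]

theorem IsEigSeq.antitone_rpow {H : Matrix (Fin m) (Fin m) ℂ} {a : ℕ → ℝ} (ha : IsEigSeq H a)
    {r : ℝ} (hr : 0 ≤ r) : Antitone fun i => a i ^ r := fun _ _ hij =>
  Real.rpow_le_rpow (ha.nonneg _) (ha.antitone hij) hr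

theorem sum_range_le_of_prod_le {a b : ℕ → ℝ} (ha : Antitone a) (ha0 : ∀ i, 0 ≤ a i)
    (hb0 : ∀ i, 0 ≤ b i) (h : ∀ k ≤ m, ∏ i ∈ range k, a i ≤ ∏ i ∈ range k, b i) :
    ∑ i ∈ range m, a i ≤ ∑ i ∈ range m, b i := by
  simpa using (sum_mul_le_sum_mul_of_prod_le (c := fun _ => 1) ha ha0 hb0 antitone_const
    (fun _ => zero_le_one) h).1

/-- Weak log-majorization holds both ways between the spectrum at q and the squared spectrum at q /
2: by tightness one way, by the midpoint of q and 0 the other. Hence the traces agree. -/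
theorem commute_of_eigSeq_eq {A B : Matrix (Fin m) (Fin m) ℂ} (hA : A.PosSemidef)
    (hB : B.PosSemidef) {p q : ℝ} (hp : 0 < p) (hpq : p < q)
    (h : ∀ i < m, eigSeq (arakiCore A B p) i ^ (1 / p) = eigSeq (arakiCore A B q) i ^ (1 / q)) :
    A * B = B * A := by
  have hq : 0 < q := hp.trans hpq
  have ep := isEigSeq_arakiCore A B p
  have eq' := isEigSeq_arakiCore A B q
  have eh := isEigSeq_arakiCore A B (q / 2)
  have hprod : ∀ k ≤ m, ∏ i ∈ range k, eigSeq (arakiCore A B q) i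
      ≤ ∏ i ∈ range k, eigSeq (arakiCore A B (q / 2)) i ^ (2 : ℝ) := fun k hk => by
    rw [Real.finsetProd_rpow _ _ fun i _ => eh.nonneg i, Real.rpow_two]
    refine prod_eigSeq_arakiCore_le_sq_half hA hB hk hp hpq ?_
    rw [← Real.finsetProd_rpow _ _ fun i _ => eq'.nonneg i]
    refine prod_congr rfl fun i hi => ?_
    have h1 := h i ((mem_range.1 hi).trans_le hk)
    rw [show p / q = 1 / q * p by ring, Real.rpow_mul (eq'.nonneg i), ← h1,
      ← Real.rpow_mul (ep.nonneg i), one_div_mul_cancel hp.ne', Real.rpow_one]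
  have hprod' : ∀ k ≤ m, ∏ i ∈ range k, eigSeq (arakiCore A B (q / 2)) i ^ (2 : ℝ)
      ≤ ∏ i ∈ range k, eigSeq (arakiCore A B q) i := fun k hk => by
    rw [Real.finsetProd_rpow _ _ fun i _ => eh.nonneg i, Real.rpow_two]
    have := prod_eigSeq_arakiCore_midpoint hA hB hk hq.le le_rfl
    rwa [add_zero, prod_eigSeq_arakiCore_zero hA hB hk, mul_one] at this
  have hsum := le_antisymm
    (sum_range_le_of_prod_le eq'.antitone eq'.nonneg (fun i => Real.rpow_nonneg (eh.nonneg i) 2)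
      hprod)
    (sum_range_le_of_prod_le (eh.antitone_rpow zero_le_two)
      (fun i => Real.rpow_nonneg (eh.nonneg i) 2) eq'.nonneg hprod')
  obtain ⟨t1, t2⟩ := trace_arakiCore_sq_half hA hB q
  rw [eq'.trace_eq (posSemidef_arakiCore A B q), hsum] at t1
  rw [eh.trace_rpow] at t2
  exact hA.commute_of_rpow hB (half_pos hq) (commute_of_trace_eq (Matrix.isHermitian_rpow A _)
    (Matrix.isHermitian_rpow B _) (t1.symm.trans t2))

theorem arakiMean_norm_le (hN : IsUnitarilyInvariantNorm N) {A B : Matrix (Fin m) (Fin m) ℂ}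
    (hA : A.PosSemidef) (hB : B.PosSemidef) {p q : ℝ} (hp : 0 < p) (hpq : p < q) :
    N (arakiMean A B p) ≤ N (arakiMean A B q) ∧ (IsStrictlyIncreasingNorm N →
      N (arakiMean A B p) = N (arakiMean A B q) → A * B = B * A) := by
  have ep := isEigSeq_arakiCore A B p
  have eq' := isEigSeq_arakiCore A B q
  have := hN.realDiagonal_le_of_prod_le
    (ep.antitone_rpow (one_div_nonneg.2 hp.le))
    (fun i => Real.rpow_nonneg (ep.nonneg i) _) (fun i => Real.rpow_nonneg (eq'.nonneg i) _)
    (fun k hk => prod_eigSeq_rpow_le hA hB hk hp hpq)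
  rw [hN.arakiMean_eq, hN.arakiMean_eq]
  exact ⟨this.1, fun hs h => commute_of_eigSeq_eq hA hB hp hpq (this.2 hs h)⟩

end UnitarilyInvariant

/-! ### The mean of commuting matrices. -/

section Commuting

open Matrix
open scoped Matrix.Norms.L2Operator ComplexStarModule

variable {m : ℕ}

theorem Matrix.continuousOn_spectrum (T : Matrix (Fin m) (Fin m) ℂ) (f : ℂ → ℂ) :
    ContinuousOn f (spectrum ℂ T) :=
  T.finite_spectrum.continuousOn f

theorem Matrix.cfc_ofReal_rpow {T : Matrix (Fin m) (Fin m) ℂ} (hT : IsStarNormal T) {f : ℂ → ℝ}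
    (hf : ∀ z ∈ spectrum ℂ T, 0 ≤ f z) (p : ℝ) :
    (cfc (fun z => ((f z : ℝ) : ℂ)) T) ^ p = cfc (fun z => ((f z ^ p : ℝ) : ℂ)) T := by
  have h0 : 0 ≤ cfc (fun z => ((f z : ℝ) : ℂ)) T :=
    cfc_nonneg fun z hz => Complex.zero_le_real.2 (hf z hz)
  rw [CFC.rpow_eq_cfc_real h0, cfc_real_eq_complex (fun x : ℝ => x ^ p),
    ← cfc_comp' (fun x : ℂ => ((x.re ^ p : ℝ) : ℂ)) (fun z => ((f z : ℝ) : ℂ)) T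
      ((T.finite_spectrum.image _).continuousOn _) (T.continuousOn_spectrum _)]
  simp only [Complex.ofReal_re]

/-- A and B are the real and imaginary parts of the normal matrix T = A + iB, so its functional
calculus reduces the claim to nonnegative scalars. -/
theorem arakiMean_eq_mul_of_commute {A B : Matrix (Fin m) (Fin m) ℂ} (hA : A.PosSemidef)
    (hB : B.PosSemidef) (h : A * B = B * A) {p : ℝ} (hp : 0 < p) : arakiMean A B p = A * B := by
  have hAs : IsSelfAdjoint A := hA.1
  have hBs : IsSelfAdjoint B := hB.1
  set T := A + Complex.I • B with hT
  have hTs : star T = A - Complex.I • B := by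
    rw [hT, star_add, star_smul, hAs.star_eq, hBs.star_eq, Complex.star_def, Complex.conj_I,
      neg_smul, sub_eq_add_neg]
  have hTn : IsStarNormal T := by
    refine ⟨?_⟩
    rw [hTs]
    change (A - Complex.I • B) * (A + Complex.I • B) = (A + Complex.I • B) * (A - Complex.I • B)
    simp only [sub_mul, mul_sub, add_mul, mul_add, smul_mul_assoc, mul_smul_comm, smul_add,
      smul_sub, h]
    abel
  have hre : ((ℜ T : selfAdjoint _) : Matrix (Fin m) (Fin m) ℂ) = A := by
    rw [realPart_apply_coe, hTs, hT, add_add_sub_cancel, ← two_smul ℝ A, smul_smul]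
    norm_num
  have him : ((ℑ T : selfAdjoint _) : Matrix (Fin m) (Fin m) ℂ) = B := by
    rw [imaginaryPart_apply_coe, hTs, hT, add_sub_sub_cancel, ← two_smul ℝ (Complex.I • B),
      smul_smul, inv_mul_cancel₀ two_ne_zero, one_smul, smul_smul]
    simp
  have hA' : A = cfc (fun z : ℂ => ((z.re : ℝ) : ℂ)) T := by rw [cfc_re_id T, hre]
  have hB' : B = cfc (fun z : ℂ => ((z.im : ℝ) : ℂ)) T := by rw [cfc_im_id T, him]
  have hsre : ∀ z ∈ spectrum ℂ T, 0 ≤ z.re := fun z hz => by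
    refine spectrum_nonneg_of_nonneg (Matrix.nonneg_iff_posSemidef.2 hA) ?_
    rw [← hre, spectrum_realPart' T]
    exact ⟨z, hz, rfl⟩
  have hsim : ∀ z ∈ spectrum ℂ T, 0 ≤ z.im := fun z hz => by
    refine spectrum_nonneg_of_nonneg (Matrix.nonneg_iff_posSemidef.2 hB) ?_
    rw [← him, spectrum_imaginaryPart' T]
    exact ⟨z, hz, rfl⟩
  have hmul : ∀ f g : ℂ → ℂ, cfc f T * cfc g T = cfc (fun z => f z * g z) T := fun f g =>
    (cfc_mul f g T (T.continuousOn_spectrum f) (T.continuousOn_spectrum g)).symm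
  have hcore : A ^ (p / 2) * B ^ p * A ^ (p / 2)
      = cfc (fun z : ℂ => (((z.re * z.im) ^ p : ℝ) : ℂ)) T := by
    rw [hA', hB', Matrix.cfc_ofReal_rpow hTn hsre, Matrix.cfc_ofReal_rpow hTn hsim, hmul, hmul]
    refine cfc_congr fun z hz => ?_
    have h1 : z.re ^ (p / 2) * z.re ^ (p / 2) = z.re ^ p := by
      rw [← Real.rpow_add' (hsre z hz) (by linarith), add_halves]
    rw [Real.mul_rpow (hsre z hz) (hsim z hz), ← h1]
    push_cast
    ring
  have hpos : ∀ z ∈ spectrum ℂ T, 0 ≤ z.re * z.im := fun z hz => mul_nonneg (hsre z hz) (hsim z hz)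
  rw [arakiMean, hcore, Matrix.cfc_ofReal_rpow hTn fun z hz => Real.rpow_nonneg (hpos z hz) _]
  conv_rhs => rw [hA', hB', hmul]
  refine cfc_congr fun z hz => ?_
  rw [← Real.rpow_mul (hpos z hz), mul_one_div_cancel hp.ne', Real.rpow_one, Complex.ofReal_mul]

end Commuting

/-! ### Chernoff's product formula. -/

section Chernoff

open Filter Topology

variable {𝔸 : Type*} [NormedRing 𝔸] [NormOneClass 𝔸]

theorem norm_pow_sub_pow_le {x y : 𝔸} {M : ℝ} (hM : 1 ≤ M) (hx : ‖x‖ ≤ M) (hy : ‖y‖ ≤ M) (n : ℕ) :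
    ‖x ^ n - y ^ n‖ ≤ n * M ^ n * ‖x - y‖ := by
  induction n with
  | zero => simp
  | succ n ih =>
    have hM0 : 0 ≤ M := zero_le_one.trans hM
    have h1 : x ^ (n + 1) - y ^ (n + 1) = x ^ n * (x - y) + (x ^ n - y ^ n) * y := by
      rw [pow_succ, pow_succ]; noncomm_ring
    have h2 : ‖x ^ n‖ ≤ M ^ n := (norm_pow_le x n).trans (pow_le_pow_left₀ (norm_nonneg _) hx n)
    calc ‖x ^ (n + 1) - y ^ (n + 1)‖ ≤ ‖x ^ n * (x - y)‖ + ‖(x ^ n - y ^ n) * y‖ := by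
          rw [h1]; exact norm_add_le _ _
      _ ≤ M ^ n * ‖x - y‖ + n * M ^ n * ‖x - y‖ * M :=
          add_le_add ((norm_mul_le _ _).trans (mul_le_mul_of_nonneg_right h2 (norm_nonneg _)))
            ((norm_mul_le _ _).trans (mul_le_mul ih hy (norm_nonneg _) (by positivity)))
      _ ≤ M ^ n * M * ‖x - y‖ + n * M ^ n * ‖x - y‖ * M :=
          add_le_add (mul_le_mul_of_nonneg_right
            (le_mul_of_one_le_right (by positivity) hM) (norm_nonneg _)) le_rfl
      _ = _ := by push_cast; ring

variable [NormedAlgebra ℝ 𝔸]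

/-- Chernoff's product formula: two curves through `1` with the same derivative at `0`. -/
theorem tendsto_pow_sub_pow_of_hasDerivAt {f g : ℝ → 𝔸} {L : 𝔸} (hf : HasDerivAt f L 0)
    (hg : HasDerivAt g L 0) (hf0 : f 0 = 1) (hg0 : g 0 = 1) :
    Tendsto (fun n : ℕ => f (1 / n) ^ n - g (1 / n) ^ n) atTop (𝓝 0) := by
  have hlim : Tendsto (fun n : ℕ => (1 / n : ℝ)) atTop (𝓝 0) := tendsto_one_div_atTop_nhds_zero_nat
  obtain ⟨C₁, hC₁⟩ := hf.isBigO_sub.bound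
  obtain ⟨C₂, hC₂⟩ := hg.isBigO_sub.bound
  set C := max 0 (max C₁ C₂) with hC
  have hC0 : 0 ≤ C := le_max_left _ _
  -- Both curves have norm at most 1 + C/n at 1/n, and (1 + C/n)^n ≤ e^C. What remains is n‖f(1/n) -
  -- g(1/n)‖, which tends to 0 as the derivatives agree.
  have hsub : Tendsto (fun n : ℕ => Real.exp C * (‖f (1 / n) - g (1 / n)‖ / ‖(1 / n : ℝ)‖)) atTop
      (𝓝 (Real.exp C * 0)) := by
    have hd := hf.sub hg
    rw [sub_self] at hd
    have ho := hasDerivAt_iff_isLittleO.1 hd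
    simp only [Pi.sub_apply, hf0, hg0, sub_self, sub_zero, smul_zero] at ho
    have := (ho.norm_norm.tendsto_div_nhds_zero).comp hlim
    exact this.const_mul _
  rw [mul_zero] at hsub
  refine squeeze_zero_norm' ?_ hsub
  filter_upwards [hlim.eventually hC₁, hlim.eventually hC₂, eventually_gt_atTop 0] with n h1 h2 hn
  have hn' : (0 : ℝ) < n := Nat.cast_pos.2 hn
  have hnorm : ‖(1 / n : ℝ)‖ = 1 / n := by rw [Real.norm_eq_abs, abs_of_pos (by positivity)]
  have hbd : ∀ (x : 𝔸) (D : ℝ), D ≤ C → ‖x - 1‖ ≤ D * (1 / n) → ‖x‖ ≤ 1 + C / n :=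
    fun x D hD hx => by
      have h3 := norm_add_le (x - 1) 1
      rw [sub_add_cancel, norm_one] at h3
      have h4 : D * (1 / n) ≤ C * (1 / n) := mul_le_mul_of_nonneg_right hD (by positivity)
      rw [mul_one_div C] at h4
      linarith
  rw [hf0, sub_zero, hnorm] at h1
  rw [hg0, sub_zero, hnorm] at h2
  have hb1 := hbd _ C₁ ((le_max_left _ _).trans (le_max_right _ _)) h1
  have hb2 := hbd _ C₂ ((le_max_right _ _).trans (le_max_right _ _)) h2
  have hM : (1 : ℝ) ≤ 1 + C / n := by
    have : 0 ≤ C / n := by positivity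
    linarith
  refine (norm_pow_sub_pow_le hM hb1 hb2 n).trans ?_
  have hexp : (1 + C / n) ^ n ≤ Real.exp C := by
    calc (1 + C / n) ^ n ≤ Real.exp (C / n) ^ n :=
          pow_le_pow_left₀ (by linarith) (by linarith [Real.add_one_le_exp (C / n)]) n
      _ = Real.exp C := by rw [← Real.exp_nat_mul, mul_div_cancel₀ _ hn'.ne']
  rw [hnorm, div_div_eq_mul_div, div_one]
  calc n * (1 + C / n) ^ n * ‖f (1 / n) - g (1 / n)‖
      ≤ n * Real.exp C * ‖f (1 / n) - g (1 / n)‖ := by gcongr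
    _ = _ := by ring

end Chernoff

/-! ### Equality in Golden–Thompson. -/

section GoldenThompson

open Filter Topology Matrix Finset
open scoped Matrix.Norms.L2Operator

variable {m : ℕ}

theorem trace_arakiMean (A B : Matrix (Fin m) (Fin m) ℂ) (p : ℝ) : (arakiMean A B p).trace
      = ((∑ i ∈ range m, eigSeq (arakiCore A B p) i ^ (1 / p) : ℝ) : ℂ) :=
  (isEigSeq_arakiCore A B p).trace_rpow _

theorem trace_arakiMean_le {A B : Matrix (Fin m) (Fin m) ℂ} (hA : A.PosSemidef)
    (hB : B.PosSemidef) {p q : ℝ} (hp : 0 < p) (hpq : p < q) :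
    (arakiMean A B p).trace.re ≤ (arakiMean A B q).trace.re := by
  have ep := isEigSeq_arakiCore A B p
  have eq' := isEigSeq_arakiCore A B q
  rw [trace_arakiMean, trace_arakiMean, Complex.ofReal_re, Complex.ofReal_re]
  exact sum_range_le_of_prod_le (ep.antitone_rpow (one_div_nonneg.2 hp.le))
    (fun i => Real.rpow_nonneg (ep.nonneg i) _) (fun i => Real.rpow_nonneg (eq'.nonneg i) _)
    fun k hk => prod_eigSeq_rpow_le hA hB hk hp hpq

theorem Matrix.IsHermitian.posSemidef_exp {H : Matrix (Fin m) (Fin m) ℂ} (hH : H.IsHermitian) :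
    (NormedSpace.exp H).PosSemidef := by
  have hs : IsSelfAdjoint H := hH
  rw [← Matrix.nonneg_iff_posSemidef, ← CFC.real_exp_eq_normedSpace_exp hs]
  exact cfc_nonneg fun x _ => (Real.exp_pos x).le

theorem Matrix.IsHermitian.exp_rpow {H : Matrix (Fin m) (Fin m) ℂ} (hH : H.IsHermitian) (t : ℝ) :
    (NormedSpace.exp H) ^ t = NormedSpace.exp (t • H) := by
  have hs : IsSelfAdjoint H := hH
  have hts : IsSelfAdjoint (t • H) := (IsSelfAdjoint.all t).smul hs
  rw [CFC.rpow_eq_cfc_real (Matrix.nonneg_iff_posSemidef.2 hH.posSemidef_exp),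
    ← CFC.real_exp_eq_normedSpace_exp hs, ← CFC.real_exp_eq_normedSpace_exp hts,
    ← cfc_comp_smul t Real.exp H, ← cfc_comp' (fun x : ℝ => x ^ t) Real.exp H
      ((H.finite_real_spectrum.image _).continuousOn _)]
  refine cfc_congr fun x _ => ?_
  rw [← Real.exp_mul, smul_eq_mul, mul_comm]

/-- At p = 1/n the mean is the n-th power of e^(tH/2) e^(tK) e^(tH/2) at t = 1/n, a curve with
derivative H + K at 0. Nonemptiness gives ‖1‖ = 1. -/
theorem tendsto_arakiMean_exp {H K : Matrix (Fin m) (Fin m) ℂ} (hH : H.IsHermitian)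
    (hK : K.IsHermitian) [Nonempty (Fin m)] :
    Tendsto (fun n : ℕ => arakiMean (NormedSpace.exp H) (NormedSpace.exp K) (1 / n)) atTop
      (𝓝 (NormedSpace.exp (H + K))) := by
  have hexp : ∀ X : Matrix (Fin m) (Fin m) ℂ,
      HasDerivAt (fun t : ℝ => NormedSpace.exp (t • X)) X 0 := fun X => by
    have := hasDerivAt_exp_smul_const (𝕂 := ℝ) X 0
    rwa [zero_smul, NormedSpace.exp_zero, one_mul] at this
  have hf : HasDerivAt (fun t : ℝ => NormedSpace.exp (t • ((1 / 2 : ℝ) • H)) *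
      NormedSpace.exp (t • K) * NormedSpace.exp (t • ((1 / 2 : ℝ) • H))) (H + K) 0 := by
    have := ((hexp ((1 / 2 : ℝ) • H)).mul (hexp K)).mul (hexp ((1 / 2 : ℝ) • H))
    simp only [Pi.mul_apply, zero_smul, NormedSpace.exp_zero, mul_one, one_mul] at this
    refine HasDerivAt.congr_deriv this ?_
    rw [add_right_comm, ← add_smul]
    norm_num
  have h := tendsto_pow_sub_pow_of_hasDerivAt hf (hexp (H + K)) (by simp) (by simp)
  have h2 := h.add_const (NormedSpace.exp (H + K))
  rw [zero_add] at h2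
  refine h2.congr' ?_
  filter_upwards [eventually_gt_atTop 0] with n hn
  have hn' : (n : ℝ) ≠ 0 := Nat.cast_ne_zero.2 hn.ne'
  rw [← Matrix.exp_nsmul, ← Nat.cast_smul_eq_nsmul ℝ, smul_smul (n : ℝ), mul_one_div_cancel hn',
    one_smul, sub_add_cancel, arakiMean, ← arakiCore, one_div_one_div,
    CFC.rpow_natCast _ n (Matrix.nonneg_iff_posSemidef.2 (posSemidef_arakiCore _ _ _)),
    arakiCore, hH.exp_rpow, hK.exp_rpow, smul_smul, mul_one_div]

/-- Equality in the Golden–Thompson inequality forces commutation. -/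
theorem commute_of_trace_exp_eq {H K : Matrix (Fin m) (Fin m) ℂ} (hH : H.IsHermitian)
    (hK : K.IsHermitian) (h : (NormedSpace.exp (H + K)).trace
      = (NormedSpace.exp H * NormedSpace.exp K).trace) : H * K = K * H := by
  rcases isEmpty_or_nonempty (Fin m) with hm | hm
  · exact Subsingleton.elim _ _
  have hA := hH.posSemidef_exp
  have hB := hK.posSemidef_exp
  have hHs : IsSelfAdjoint H := hH
  have hKs : IsSelfAdjoint K := hK
  set A := NormedSpace.exp H with hAdef
  set B := NormedSpace.exp K with hBdef
  have h1 : arakiMean A B 1 = arakiCore A B 1 := by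
    rw [arakiMean, ← arakiCore, one_div_one,
      CFC.rpow_one _ (Matrix.nonneg_iff_posSemidef.2 (posSemidef_arakiCore A B 1))]
  have h2 : arakiMean A B (1 / 2) = arakiCore A B (1 / 2) ^ (2 : ℝ) := by
    rw [arakiMean, one_div_one_div, arakiCore]
  have hT1 : (arakiCore A B 1).trace = (A * B).trace := by
    rw [arakiCore, Matrix.trace_mul_comm, ← Matrix.mul_assoc, hA.rpow_half_mul_self,
      CFC.rpow_one A (Matrix.nonneg_iff_posSemidef.2 hA),
      CFC.rpow_one B (Matrix.nonneg_iff_posSemidef.2 hB)]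
  have hlim : Tendsto (fun n : ℕ => (arakiMean A B (1 / n)).trace.re) atTop
      (𝓝 (NormedSpace.exp (H + K)).trace.re) :=
    ((Complex.continuous_re.comp (continuous_id.matrix_trace)).tendsto _).comp
      (tendsto_arakiMean_exp hH hK)
  have hle : (NormedSpace.exp (H + K)).trace.re ≤ (arakiMean A B (1 / 2)).trace.re := by
    refine le_of_tendsto hlim ?_
    filter_upwards [eventually_gt_atTop 2] with n hn
    have hn' : (2 : ℝ) < n := by exact_mod_cast hn
    exact trace_arakiMean_le hA hB (by positivity)
      (one_div_lt_one_div_of_lt two_pos hn')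
  have hle2 := trace_arakiMean_le hA hB (p := 1 / 2) (q := 1) (by norm_num) (by norm_num)
  -- Tr e^(H+K) ≤ trace at 1/2 ≤ trace at 1 = Tr AB, and the hypothesis closes the chain.
  have heq : (arakiMean A B (1 / 2)).trace = (arakiMean A B 1).trace := by
    have hre : (arakiMean A B (1 / 2)).trace.re = (arakiMean A B 1).trace.re :=
      le_antisymm hle2 (by rwa [h1, hT1, ← h])
    rw [trace_arakiMean, trace_arakiMean, Complex.ofReal_re, Complex.ofReal_re] at hre
    rw [trace_arakiMean, trace_arakiMean, hre]
  obtain ⟨t1, t2⟩ := trace_arakiCore_sq_half hA hB 1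
  rw [h1, h2] at heq
  have hAB := hA.commute_of_rpow hB one_half_pos (commute_of_trace_eq (Matrix.isHermitian_rpow A _)
    (Matrix.isHermitian_rpow B _) (t1.symm.trans (heq.symm.trans t2)))
  have hc : Commute A B := hAB
  have hc2 : Commute (CFC.log A) B := hc.cfc_real _
  have hc3 : Commute (CFC.log B) (CFC.log A) := hc2.symm.cfc_real _
  rw [hAdef, hBdef, CFC.log_exp H hHs, CFC.log_exp K hKs] at hc3
  exact hc3.symm

end GoldenThompson

theorem mainTheorem5 (m : ℕ) :
    (∀ N : Seminorm ℂ (Matrix (Fin m) (Fin m) ℂ),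
      IsUnitarilyInvariantNorm N → IsStrictlyIncreasingNorm N →
      ∀ A B : Matrix (Fin m) (Fin m) ℂ, A.PosSemidef → B.PosSemidef →
      ∀ p q : ℝ, 0 < p → p < q →
        N (arakiMean A B p) ≤ N (arakiMean A B q) ∧
        (N (arakiMean A B p) = N (arakiMean A B q) ↔ A * B = B * A)) ∧
    (∀ H K : Matrix (Fin m) (Fin m) ℂ, H.IsHermitian → K.IsHermitian →
      ((NormedSpace.exp (H + K)).trace = (NormedSpace.exp H * NormedSpace.exp K).trace ↔
        H * K = K * H)) := by
  refine ⟨fun N hN hs A B hA hB p q hp hpq => ?_, fun H K hH hK => ⟨fun h => ?_, fun h => ?_⟩⟩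
  · obtain ⟨hle, heq⟩ := arakiMean_norm_le hN hA hB hp hpq
    refine ⟨hle, heq hs, fun h => ?_⟩
    rw [arakiMean_eq_mul_of_commute hA hB h hp, arakiMean_eq_mul_of_commute hA hB h (hp.trans hpq)]
  · exact commute_of_trace_exp_eq hH hK h
  · rw [Matrix.exp_add_of_commute H K h]
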